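/- For $m\ge 0$ let $\mathsf H_m=\sum_{j=1}^m\frac1j$. Generalized polylogarithms are defined recursively by $G(\,;z)=1$, $G(\underbrace{0,\dots,0}_{n};z)=\frac{\log^n z}{n!}$, and $$G(\alpha_1,\dots,\alpha_n;z)=\int_0^z\frac{\mathrm dx}{x-\alpha_1}\,G(\alpha_2,\dots,\alpha_n;x)\qquad\text{if }(\alpha_1,\dots,\alpha_n)\ne(0,\dots,0),$$ the integral being taken along the straight line segment from $0$ to $z$. For positive integers $a_j$ and nonzero complex numbers $z_j$, the multiple polylogarithm $\mathrm{Li}_{a_1,\dots,a_n}(z_1,\dots,z_n)$, i.e. the analytic continuation of $\sum_{\ell_1>\dots>\ell_n>0}\prod_{j=1}^n z_j^{\ell_j}/\ell_j^{a_j}$, is $$\mathrm{Li}_{a_1,\dots,a_n}(z_1,\dots,z_n)=(-1)^nG\Big(\underbrace{0,\dots,0}_{a_1-1},\tfrac1{z_1},\underbrace{0,\dots,0}_{a_2-1},\tfrac1{z_1z_2},\dots,\underbrace{0,\dots,0}_{a_n-1},\tfrac1{z_1\cdots z_n};1\Big);$$ thus $\mathrm{Li}_2(z)=-G(0,\frac1z;1)$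 and $\mathrm{Li}_{1,1}(z_1,z_2)=G(\frac1{z_1},\frac1{z_1z_2};1)$. Put $\theta=e^{\pi i/4}$, $\lambda=\log 2$, $\widetilde\lambda=\log(1+\sqrt2)$, $G=\operatorname{Im}\mathrm{Li}_2(i)$ (Catalan's constant), and $$L=L\Big(2,\Big(\frac{-8}{\cdot}\Big)\Big)=\sum_{n=1}^\infty\Big(\frac{-8}{n}\Big)\frac1{n^2},$$ where $\big(\frac{-8}{\cdot}\big)$ is the Kronecker symbol. Then all the series below converge, and $$\sum_{k=1}^\infty\frac{\binom{2k}k8^k}{(2k-1)\binom{3k}k\binom{6k}{3k}}=\frac{2\sqrt2\,\widetilde\lambda}{5}-\frac{\pi}{10\sqrt2},$$ $$\sum_{k=1}^\infty\frac{\big[-\mathsf H_k+2\mathsf H_{2k}+\mathsf H_{3k}-2\mathsf H_{6k}-\frac2{2k-1}\big]\binom{2k}k8^k}{(2k-1)\binom{3k}k\binom{6k}{3k}}=\frac{2\sqrt2\big[\operatorname{Re}\mathrm{Li}_{1,1}(i,\theta)+\operatorname{Im}\mathrm{Li}_2(\theta)-\frac G4\big]}5-\frac{3\lambda^2}{40\sqrt2}+\frac{\lambda\widetilde\lambda}{10\sqrt2}-\frac{\widetilde\lambda^2}{10\sqrt2}-\frac{83\pi^2}{480\sqrt2},$$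 $$\sum_{k=1}^\infty\frac{\big[\mathsf H_k-\mathsf H_{2k}+\frac2{2k-1}+2\log2\big]\binom{2k}k8^k}{(2k-1)\binom{3k}k\binom{6k}{3k}}=-\frac{\sqrt2\big[15\operatorname{Re}\mathrm{Li}_{1,1}(i,\theta)+\operatorname{Im}\mathrm{Li}_2(\theta)-\frac G4\big]}5+\frac{9\lambda^2}{16\sqrt2}+\frac{17\lambda\widetilde\lambda}{20\sqrt2}+\frac{3\widetilde\lambda^2}{4\sqrt2}-\frac{\pi\lambda}{20\sqrt2}-\frac{\pi^2}{320\sqrt2},$$ $$\sum_{k=1}^\infty\frac{\binom{2k}k8^k}{(2k-1)^2\binom{3k}k\binom{6k}{3k}}=\sqrt2\operatorname{Re}\mathrm{Li}_{1,1}(i,\theta)-\frac{3\lambda^2}{16\sqrt2}+\frac{\lambda\widetilde\lambda}{4\sqrt2}-\frac{\widetilde\lambda}{\sqrt2}-\frac{\widetilde\lambda^2}{4\sqrt2}+\frac{\pi}{4\sqrt2}+\frac{13\pi^2}{192\sqrt2}.$$ Consequently, $$\sum_{k=1}^\infty\frac{\big[(5k-1)(\mathsf H_{2k-1}-\mathsf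 H_{k-1})-\frac{3(6k-1)}{4(2k-1)}\big]\binom{2k}k8^k}{k(2k-1)\binom{3k}k\binom{6k}{3k}}=\frac{3\sqrt2\,\pi\log2}8-L,$$ $$\sum_{k=1}^\infty\frac{\big[(5k-1)(2\mathsf H_{6k-1}-\mathsf H_{3k-1}-\mathsf H_{k-1})-\frac{2(3k-1)}{2k-1}\big]\binom{2k}k8^k}{k(2k-1)\binom{3k}k\binom{6k}{3k}}=\frac{3\sqrt2\,\pi\log2}4,$$ $$\sum_{k=1}^\infty\frac{\big[(5k-1)(12\mathsf H_{6k-1}-6\mathsf H_{3k-1}-4\mathsf H_{2k-1}-2\mathsf H_{k-1})-9\big]\binom{2k}k8^k}{k(2k-1)\binom{3k}k\binom{6k}{3k}}=3\sqrt2\,\pi\log2+4L.$$ -/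

import Mathlib

noncomputable section

open scoped Nat

/-- Generalized polylogarithm `G(α₁, …, αₙ; z)`: it is `1` for the empty word, `logⁿ z / n!` for the
word of `n` zeros, and otherwise `∫₀^z dx / (x - α₁) · G(α₂, …, αₙ; x)` along the straight segment
from `0` to `z`, which is parametrized here by `x = t z` with `t ∈ [0, 1]`. -/
def GPL : List ℂ → ℂ → ℂ
  | [], _ => 1
  | a :: as, z =>
    open Classical in
    if ∀ α ∈ a :: as, α = 0 then
      Complex.log z ^ (as.length + 1) / ((as.length + 1)! : ℂ)
    else
      ∫ t in (0 : ℝ)..1, z / ((t : ℂ) * z - a) * GPL as ((t : ℂ) * z)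

/-- For `s = [(a₁, z₁), …, (aₙ, zₙ)]`, the word
`0^(a₁-1), 1/(p z₁), 0^(a₂-1), 1/(p z₁ z₂), …, 0^(aₙ-1), 1/(p z₁ ⋯ zₙ)`. -/
def mplWord : ℂ → List (ℕ+ × ℂ) → List ℂ
  | _, [] => []
  | p, (a, z) :: s => List.replicate ((a : ℕ) - 1) 0 ++ (p * z)⁻¹ :: mplWord (p * z) s

/-- Multiple polylogarithm `Li_{a₁, …, aₙ}(z₁, …, zₙ)` for `s = [(a₁, z₁), …, (aₙ, zₙ)]` with
nonzero `zⱼ`, as the analytic continuation of `∑_{ℓ₁ > ⋯ > ℓₙ > 0} ∏ⱼ zⱼ ^ ℓⱼ / ℓⱼ ^ aⱼ` given by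
`(-1)ⁿ G(0^(a₁-1), 1/z₁, 0^(a₂-1), 1/(z₁ z₂), …, 0^(aₙ-1), 1/(z₁ ⋯ zₙ); 1)`. -/
def MPL (s : List (ℕ+ × ℂ)) : ℂ :=
  (-1) ^ s.length * GPL (mplWord 1 s) 1

/-- `θ = e^{π i / 4}`. -/
def theta : ℂ := Complex.exp (Real.pi * Complex.I / 4)

/-- `Re Li_{1,1}(i, θ)`. -/
def reLi11 : ℝ := (MPL [(1, Complex.I), (1, theta)]).re

/-- `Im Li₂(θ)`. -/
def imLi2 : ℝ := (MPL [(2, theta)]).im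

/-- Catalan's constant `G = Im Li₂(i)`. -/
def catalanG : ℝ := (MPL [(2, Complex.I)]).im

/-- `L = L(2, (-8/·)) = ∑_{n ≥ 1} (-8/n) / n²`. The Kronecker symbol `(-8/·)` is the character
`ZMod.χ₈'` modulo `8` with value `1` at `1, 3`, value `-1` at `5, 7` and value `0` at even
numbers; the term with `n = 0` is zero. -/
def LConst : ℝ := ∑' n : ℕ, (ZMod.χ₈' (n : ZMod 8) : ℝ) / (n : ℝ) ^ 2

/-- The harmonic number `H_m = ∑_{j = 1}^m 1/j` as a real number. -/
def H (m : ℕ) : ℝ := (harmonic m : ℝ)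

/-- The factor `C(2k,k) 8^k / (C(3k,k) C(6k,3k))`. -/
def binomFactor (k : ℕ) : ℝ :=
  ((2 * k).choose k : ℝ) * 8 ^ k / (((3 * k).choose k : ℝ) * ((6 * k).choose (3 * k) : ℝ))

/-- The series `∑_{k = 1}^∞ f k` converges (absolutely) to `s`. -/
def HasSumFromOne (f : ℕ → ℝ) (s : ℝ) : Prop :=
  HasSum (fun n : ℕ => f (n + 1)) s

end

open intervalIntegral
open MeasureTheory (volume)

/-! Up to powers of 2, the coefficients are beta integrals. With c_k = `binomFactor k`, one has
c_k/(2k-1) = 2^{-k} ∫₀¹ y^{2k-2}(1-y²)^{2k} dy and c_k/k = 4·2^{-k} ∫₀¹ y^{2k}(1-y²)^{2k-1} dy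
(`evenBeta_first`, `evenBeta_second`). Inserting log y or log(1-y²) amounts to differentiating the
beta function in a parameter and produces the harmonic numbers. Summation over k gives geometric
series of ratio y²(1-y²)²/2, and the decisive fact is 1 - y²(1-y²)²/2 = (2-y²)(1+y⁴)/2. Partial
fractions then express every series through nine integrals: 1, log y and log(1-y²) against 1/(2-y²),
1/(1+y⁴) and y²/(1+y⁴). The square 1/(2k-1)² comes from one more integration by parts
(`evenBeta_third`).

The nine integrals involve π, log 2, log(1+√2), L and a single dilogarithm Li₂(ρ), ρ = √2-1. Against
1/(2-y²), the functional equations of the real dilogarithm apply, helped by ρ being the fixed point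
of x ↦ (1-x)/(1+x). Against 1/(1+y⁴), log y gives Li₂(θ) - Li₂(-θ), whose real part is a Bernoulli
polynomial value and whose imaginary part is √2 L. For log(1-y²), the substitution x = 2y/(1+y²)
handles the combination (1-y²)/(1+y⁴) and tan ψ = √2 y/(1-y²) handles (1+y²)/(1+y⁴).

On the other side, Im Li₂(θ) - G/4 = L/√2 by duplication, and Re Li_{1,1}(i,θ) equals -Li₂(ρ)/2 plus
elementary terms (`reLi11_eq`); this needs Re Li₂ along a line, a ray and a special curve. The first
four series follow by comparison. For the others, (5k-1)/(k(2k-1)) = 1/k + 3/(2k-1), and in the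
resulting combinations Li₂(ρ) cancels. -/

/-- The fundamental theorem of calculus with the antiderivative as an explicit argument. -/
theorem integral_eq_of_antideriv {a b : ℝ} (F : ℝ → ℝ) {f : ℝ → ℝ} (hab : a ≤ b)
    (hc : ContinuousOn F (Set.Icc a b)) (hd : ∀ x ∈ Set.Ioo a b, HasDerivAt F (f x) x)
    (hi : IntervalIntegrable f volume a b) : ∫ y in a..b, f y = F b - F a :=
  integral_eq_sub_of_hasDerivAt_of_le hab hc hd hi

/-! ### Beta integrals with logarithmic weights. -/

/-- The value of `∫₀¹ y^(2m) (1 - y²)^n dy`. -/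
noncomputable def evenBeta (m n : ℕ) : ℝ :=
  (n.factorial * (2 * m).factorial * (m + n + 1).factorial * 2 ^ (2 * n + 1) : ℝ) /
    (m.factorial * (2 * m + 2 * n + 2).factorial)

/-- The sum `1 + 1/3 + ⋯ + 1/(2N-1)` of odd reciprocals. -/
noncomputable def oddHarmonic (N : ℕ) : ℝ := H (2 * N) - H N / 2

theorem H_succ (n : ℕ) : H (n + 1) = H n + 1 / ((n : ℝ) + 1) := by
  simp [H, harmonic_succ]

theorem H_zero : H 0 = 0 := by simp [H]

theorem oddHarmonic_zero : oddHarmonic 0 = 0 := by simp [oddHarmonic, H_zero]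

theorem oddHarmonic_succ (N : ℕ) :
    oddHarmonic (N + 1) = oddHarmonic N + 1 / (2 * (N : ℝ) + 1) := by
  rw [oddHarmonic, oddHarmonic, show 2 * (N + 1) = 2 * N + 1 + 1 by ring, H_succ, H_succ, H_succ]
  have : (2 * (N : ℝ) + 1) ≠ 0 := by positivity
  have : ((N : ℝ) + 1) ≠ 0 := by positivity
  push_cast
  field_simp
  ring

theorem evenBeta_zero_right (m : ℕ) : evenBeta m 0 = 1 / (2 * (m : ℝ) + 1) := by
  have h1 : (m.factorial : ℝ) ≠ 0 := by positivity
  have h2 : ((2 * m).factorial : ℝ) ≠ 0 := by positivity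
  have h3 : (2 * (m : ℝ) + 1) ≠ 0 := by positivity
  have h4 : ((m : ℝ) + 1) ≠ 0 := by positivity
  simp only [evenBeta, Nat.factorial_succ, Nat.factorial_zero, add_zero, mul_zero]
  push_cast
  field_simp
  ring

/-- Together with `evenBeta_succ_eq_mul`, this makes all beta values in an induction step rational
multiples of the single value at (m, n+1). -/
theorem evenBeta_eq_mul_succ (m n : ℕ) :
    evenBeta m n = evenBeta m (n + 1) * (2 * m + 2 * n + 3) / (2 * (n + 1)) := by
  have h1 : (m.factorial : ℝ) ≠ 0 := by positivity
  have h2 : ((2 * m + 2 * n).factorial : ℝ) ≠ 0 := by positivity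
  have h4 : ((n : ℝ) + 1) ≠ 0 := by positivity
  have h5 : (2 * (m : ℝ) + 2 * n + 1) ≠ 0 := by positivity
  have h6 : (2 * (m : ℝ) + 2 * n + 3) ≠ 0 := by positivity
  have h7 : ((m : ℝ) + n + 1) ≠ 0 := by positivity
  have h8 : ((m : ℝ) + n + 2) ≠ 0 := by positivity
  have h9 : ((m + n).factorial : ℝ) ≠ 0 := by positivity
  simp only [evenBeta, show m + (n + 1) + 1 = m + n + 1 + 1 by ring,
    show 2 * m + 2 * (n + 1) + 2 = 2 * m + 2 * n + 1 + 1 + 1 + 1 by ring,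
    show 2 * (n + 1) + 1 = 2 * n + 1 + 1 + 1 by ring,
    Nat.factorial_succ, pow_succ]
  push_cast
  rw [div_eq_div_iff (by positivity) (by positivity), div_mul_eq_mul_div,
    div_mul_eq_mul_div, eq_div_iff (by positivity)]
  ring

theorem evenBeta_succ_eq_mul (m n : ℕ) :
    evenBeta (m + 1) n = evenBeta m (n + 1) * (2 * m + 1) / (2 * (n + 1)) := by
  have h1 : (m.factorial : ℝ) ≠ 0 := by positivity
  rw [evenBeta, show 2 * (m + 1) + 2 * n + 2 = 2 * m + 2 * n + 1 + 1 + 1 + 1 by ring]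
  simp only [evenBeta, show m + (n + 1) + 1 = m + n + 1 + 1 by ring,
    show m + 1 + n + 1 = m + n + 1 + 1 by ring,
    show 2 * m + 2 * (n + 1) + 2 = 2 * m + 2 * n + 1 + 1 + 1 + 1 by ring,
    show 2 * (n + 1) + 1 = 2 * n + 1 + 1 + 1 by ring,
    show 2 * (m + 1) = 2 * m + 1 + 1 by ring,
    Nat.factorial_succ, pow_succ]
  push_cast
  rw [div_eq_div_iff (by positivity) (by positivity), div_mul_eq_mul_div,
    div_mul_eq_mul_div, eq_div_iff (by positivity)]
  ring

theorem evenBeta_succ_right (m n : ℕ) :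
    evenBeta m (n + 1) = evenBeta m n - evenBeta (m + 1) n := by
  rw [evenBeta_eq_mul_succ m n, evenBeta_succ_eq_mul]
  field_simp
  ring

/-- The linear functional `h ↦ ∫₀¹ y^(2m) (1 - y²)^n h(y) dy` of an integrable weight satisfies
the recursion of the beta function. -/
theorem integral_evenBeta_succ_right {h : ℝ → ℝ} (hh : IntervalIntegrable h volume 0 1)
    (m n : ℕ) :
    ∫ y in (0 : ℝ)..1, y ^ (2 * m) * (1 - y ^ 2) ^ (n + 1) * h y =
      (∫ y in (0 : ℝ)..1, y ^ (2 * m) * (1 - y ^ 2) ^ n * h y) -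
        ∫ y in (0 : ℝ)..1, y ^ (2 * (m + 1)) * (1 - y ^ 2) ^ n * h y := by
  rw [← integral_sub]
  · congr 1; ext y; ring
  · exact hh.continuousOn_mul (by fun_prop)
  · exact hh.continuousOn_mul (by fun_prop)

theorem integral_evenBeta (m n : ℕ) :
    ∫ y in (0 : ℝ)..1, y ^ (2 * m) * (1 - y ^ 2) ^ n = evenBeta m n := by
  induction n generalizing m with
  | zero => simp [evenBeta_zero_right]
  | succ n ih =>
    have := integral_evenBeta_succ_right (h := fun _ => 1) intervalIntegrable_const m n
    simp only [mul_one] at this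
    rw [this, ih, ih, evenBeta_succ_right]

theorem integral_pow_mul_log (m : ℕ) :
    ∫ y in (0 : ℝ)..1, y ^ m * Real.log y = -(1 / ((m : ℝ) + 1) ^ 2) := by
  have hm : ((m : ℝ) + 1) ≠ 0 := by positivity
  have key : ∫ y in (0 : ℝ)..1, y ^ m * Real.log y =
      (fun y : ℝ => y ^ m * (y * Real.log y) / (m + 1) - y ^ (m + 1) / (m + 1) ^ 2) 1 -
      (fun y : ℝ => y ^ m * (y * Real.log y) / (m + 1) - y ^ (m + 1) / (m + 1) ^ 2) 0 := by
    -- Grouping y · log y keeps the primitive continuous at 0.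
    refine integral_eq_of_antideriv
      (fun y : ℝ => y ^ m * (y * Real.log y) / (m + 1) - y ^ (m + 1) / (m + 1) ^ 2)
      zero_le_one ?_ ?_ ?_
    · have := Real.continuous_mul_log
      fun_prop
    · intro x hx
      have hx0 : x ≠ 0 := hx.1.ne'
      have h1 := (hasDerivAt_pow (m + 1) x).mul (Real.hasDerivAt_log hx0)
      have h2 := (h1.div_const ((m : ℝ) + 1)).sub
        ((hasDerivAt_pow (m + 1) x).div_const (((m : ℝ) + 1) ^ 2))
      refine (h2.congr_of_eventuallyEq (Filter.Eventually.of_forall fun y => ?_)).congr_deriv ?_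
      · simp only [Pi.sub_apply, Pi.mul_apply]; ring
      · push_cast
        field_simp
        ring
    · exact intervalIntegrable_log'.continuousOn_mul (by fun_prop)
  rw [key]
  simp

/-- The weight log y is a derivative of the beta integral in its first exponent. In discrete form,
both sides satisfy the recursion obtained from (1-y²)^(n+1) = (1-y²)^n - y²(1-y²)^n. -/
theorem integral_evenBeta_log (m n : ℕ) :
    ∫ y in (0 : ℝ)..1, y ^ (2 * m) * (1 - y ^ 2) ^ n * Real.log y =
      -(evenBeta m n * (oddHarmonic (m + n + 1) - oddHarmonic m)) := by
  induction n generalizing m with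
  | zero =>
    simp only [pow_zero, mul_one, integral_pow_mul_log, evenBeta_zero_right, add_zero,
      oddHarmonic_succ]
    have : (2 * (m : ℝ) + 1) ≠ 0 := by positivity
    push_cast
    field_simp
    ring
  | succ n ih =>
    rw [integral_evenBeta_succ_right intervalIntegrable_log', ih, ih, evenBeta_eq_mul_succ m n,
      evenBeta_succ_eq_mul, show m + (n + 1) + 1 = m + n + 1 + 1 by ring,
      show m + 1 + n + 1 = m + n + 1 + 1 by ring, oddHarmonic_succ (m + n + 1),
      oddHarmonic_succ m]
    have h1 : (2 * (m : ℝ) + 1) ≠ 0 := by positivity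
    have h2 : ((n : ℝ) + 1) ≠ 0 := by positivity
    have h3 : (2 * ((m : ℝ) + n + 1) + 1) ≠ 0 := by positivity
    push_cast
    field_simp
    ring

theorem intervalIntegrable_log_one_sub_sq :
    IntervalIntegrable (fun y : ℝ => Real.log (1 - y ^ 2)) volume 0 1 := by
  have h1 : IntervalIntegrable (fun y : ℝ => Real.log (1 - y)) volume 0 1 := by
    have := (intervalIntegrable_log' (a := 1) (b := 0)).comp_sub_left 1
    simpa using this
  have h2 : IntervalIntegrable (fun y : ℝ => Real.log (1 + y)) volume 0 1 := by
    have := (intervalIntegrable_log' (a := 1) (b := 2)).comp_add_left 1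
    norm_num at this
    simpa using this
  refine (h1.add h2).congr_uIoo ?_
  intro y hy
  rw [Set.uIoo_of_le zero_le_one] at hy
  simp only
  rw [← Real.log_mul (by linarith [hy.2]) (by linarith [hy.1])]
  congr 1; ring

theorem integral_log_one_sub_sq :
    ∫ y in (0 : ℝ)..1, Real.log (1 - y ^ 2) = 2 * Real.log 2 - 2 := by
  have h1 : IntervalIntegrable (fun y : ℝ => Real.log (1 - y)) volume 0 1 := by
    have := (intervalIntegrable_log' (a := 1) (b := 0)).comp_sub_left 1
    simpa using this
  have h2 : IntervalIntegrable (fun y : ℝ => Real.log (1 + y)) volume 0 1 := by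
    have := (intervalIntegrable_log' (a := 1) (b := 2)).comp_add_left 1
    norm_num at this
    simpa using this
  have e : ∫ y in (0 : ℝ)..1, Real.log (1 - y ^ 2) =
      ∫ y in (0 : ℝ)..1, (Real.log (1 - y) + Real.log (1 + y)) := by
    apply integral_congr_Ioo_of_le zero_le_one
    intro y hy
    simp only
    rw [← Real.log_mul (by linarith [hy.2]) (by linarith [hy.1])]
    congr 1; ring
  rw [e, integral_add h1 h2, integral_comp_sub_left (fun x => Real.log x),
    integral_comp_add_left (fun x => Real.log x)]
  norm_num [integral_log]

/-- Integrate the derivative of y^(2m+1) (1-y²) log(1-y²), which vanishes at both ends. This gives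
the recursion in m for the case n = 0 below. -/
theorem integral_pow_mul_log_one_sub_sq (m : ℕ) :
    (2 * m + 1) * (∫ y in (0 : ℝ)..1, y ^ (2 * m) * Real.log (1 - y ^ 2)) =
      (2 * m + 3) * (∫ y in (0 : ℝ)..1, y ^ (2 * (m + 1)) * Real.log (1 - y ^ 2)) +
      2 / (2 * m + 3) := by
  have hi : ∀ k : ℕ, IntervalIntegrable (fun y : ℝ => y ^ k * Real.log (1 - y ^ 2)) volume 0 1 :=
    fun k => intervalIntegrable_log_one_sub_sq.continuousOn_mul (by fun_prop)
  have key : ∫ y in (0 : ℝ)..1, ((2 * m + 1) * (y ^ (2 * m) * Real.log (1 - y ^ 2)) -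
      ((2 * m + 3) * (y ^ (2 * (m + 1)) * Real.log (1 - y ^ 2)) + 2 * y ^ (2 * (m + 1)))) =
      (fun y : ℝ => y ^ (2 * m + 1) * ((1 - y ^ 2) * Real.log (1 - y ^ 2))) 1 -
      (fun y : ℝ => y ^ (2 * m + 1) * ((1 - y ^ 2) * Real.log (1 - y ^ 2))) 0 := by
    refine integral_eq_of_antideriv
      (fun y : ℝ => y ^ (2 * m + 1) * ((1 - y ^ 2) * Real.log (1 - y ^ 2)))
      zero_le_one ?_ ?_ ?_
    · have : Continuous fun y : ℝ => (1 - y ^ 2) * Real.log (1 - y ^ 2) :=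
        Real.continuous_mul_log.comp (by fun_prop : Continuous fun y : ℝ => 1 - y ^ 2)
      fun_prop
    · intro x hx
      have hx1 : 1 - x ^ 2 ≠ 0 := by nlinarith [hx.1, hx.2]
      have h0 : HasDerivAt (fun y : ℝ => 1 - y ^ 2) (-(2 * x)) x := by
        simpa using (hasDerivAt_pow 2 x).const_sub 1
      have h1 := (hasDerivAt_pow (2 * m + 1) x).mul
        ((Real.hasDerivAt_mul_log hx1).comp x h0)
      refine h1.congr_deriv ?_
      simp only [Function.comp, Nat.add_sub_cancel]
      push_cast
      ring
    · exact ((hi _).const_mul _).sub (((hi _).const_mul _).add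
        (Continuous.intervalIntegrable (by fun_prop) _ _))
  rw [integral_sub ((hi _).const_mul _) (((hi _).const_mul _).add
        (Continuous.intervalIntegrable (by fun_prop) _ _)),
    integral_add ((hi _).const_mul _) (Continuous.intervalIntegrable (by fun_prop) _ _),
    intervalIntegral.integral_const_mul, intervalIntegral.integral_const_mul,
    intervalIntegral.integral_const_mul, integral_pow] at key
  have e : (2 : ℝ) * ((1 ^ (2 * (m + 1) + 1) - 0 ^ (2 * (m + 1) + 1)) /
      ((2 * (m + 1) : ℕ) + 1)) = 2 / (2 * m + 3) := by
    simp
    rw [div_eq_mul_inv]; congr 2; ring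
  rw [e] at key
  simp at key
  linarith

theorem integral_evenBeta_log_one_sub_sq (m n : ℕ) :
    ∫ y in (0 : ℝ)..1, y ^ (2 * m) * (1 - y ^ 2) ^ n * Real.log (1 - y ^ 2) =
      evenBeta m n * (H n + 2 * Real.log 2 - 2 * oddHarmonic (m + n + 1)) := by
  induction n generalizing m with
  | zero =>
    simp only [pow_zero, mul_one, H_zero, evenBeta_zero_right, add_zero]
    induction m with
    | zero =>
      simp [integral_log_one_sub_sq, oddHarmonic_succ, oddHarmonic_zero]
    | succ m ih =>
      have h := integral_pow_mul_log_one_sub_sq m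
      have h1 : (2 * (m : ℝ) + 1) ≠ 0 := by positivity
      have h2 : (2 * (m : ℝ) + 3) ≠ 0 := by positivity
      have h3 : (2 * ((m : ℝ) + 1) + 1) ≠ 0 := by positivity
      rw [ih] at h
      rw [oddHarmonic_succ (m + 1)]
      apply mul_left_cancel₀ h2
      rw [eq_sub_of_add_eq h.symm]
      push_cast
      rw [show (2 * ((m : ℝ) + 1) + 1) = 2 * m + 3 by ring]
      field_simp
      ring
  | succ n ih =>
    rw [integral_evenBeta_succ_right intervalIntegrable_log_one_sub_sq, ih, ih,
      evenBeta_eq_mul_succ m n, evenBeta_succ_eq_mul,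
      show m + (n + 1) + 1 = m + n + 1 + 1 by ring,
      show m + 1 + n + 1 = m + n + 1 + 1 by ring, oddHarmonic_succ (m + n + 1), H_succ]
    have h2 : ((n : ℝ) + 1) ≠ 0 := by positivity
    have h3 : (2 * ((m : ℝ) + n + 1) + 1) ≠ 0 := by positivity
    push_cast
    field_simp
    ring

/-! ### Geometric summation under the integral and partial fractions. -/

theorem HasSum.of_eq {f g : ℕ → ℝ} {a b : ℝ} (h : HasSum f a) (hfg : ∀ n, g n = f n)
    (hab : b = a) : HasSum g b := by
  rw [hab, funext hfg]; exact h

theorem hasSum_integral_geometric {q h : ℝ → ℝ} (hq : Continuous q)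
    (hq0 : ∀ y ∈ Set.Icc (0 : ℝ) 1, 0 ≤ q y) (hq1 : ∀ y ∈ Set.Icc (0 : ℝ) 1, q y ≤ 1 / 2)
    (hh : IntervalIntegrable h volume 0 1) :
    HasSum (fun n : ℕ => ∫ y in (0 : ℝ)..1, q y ^ n * h y) (∫ y in (0 : ℝ)..1, h y / (1 - q y)) := by
  have hs : Summable fun n : ℕ => (1 / 2 : ℝ) ^ n := summable_geometric_two
  refine hasSum_integral_of_dominated_convergence (fun n y => (1 / 2 : ℝ) ^ n * |h y|) ?_ ?_ ?_ ?_ ?_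
  · intro n
    exact ((hh.continuousOn_mul (hq.pow n).continuousOn).def').aestronglyMeasurable
  · intro n
    refine Filter.Eventually.of_forall fun y hy => ?_
    rw [Set.uIoc_of_le zero_le_one] at hy
    have hy' : y ∈ Set.Icc (0 : ℝ) 1 := ⟨hy.1.le, hy.2⟩
    rw [norm_mul, Real.norm_eq_abs, Real.norm_eq_abs, abs_pow, abs_of_nonneg (hq0 y hy')]
    gcongr
    · exact hq0 y hy'
    · exact hq1 y hy'
  · exact Filter.Eventually.of_forall fun y _ => hs.mul_right _
  · simp_rw [tsum_mul_right]
    exact hh.abs.const_mul _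
  · refine Filter.Eventually.of_forall fun y hy => ?_
    rw [Set.uIoc_of_le zero_le_one] at hy
    have hy' : y ∈ Set.Icc (0 : ℝ) 1 := ⟨hy.1.le, hy.2⟩
    rw [div_eq_inv_mul]
    exact (hasSum_geometric_of_lt_one (hq0 y hy') (by linarith [hq1 y hy'])).mul_right _

theorem two_sub_sq_pos {y : ℝ} (hy : y ∈ Set.Icc (0 : ℝ) 1) : 0 < 2 - y ^ 2 := by
  nlinarith [hy.1, hy.2]

/-- The ratio y²(1-y²)²/2 is at most 1/2 on [0,1], and its complement to 1 factors as
(2-y²)(1+y⁴)/2. -/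
theorem hasSum_integral_kernel {h : ℝ → ℝ} (hh : IntervalIntegrable h volume 0 1) :
    HasSum (fun n : ℕ => (1 / 2 : ℝ) ^ (n + 1) *
        ∫ y in (0 : ℝ)..1, y ^ (2 * n) * (1 - y ^ 2) ^ (2 * n) * h y)
      (∫ y in (0 : ℝ)..1, h y / ((2 - y ^ 2) * (1 + y ^ 4))) := by
  have key := (hasSum_integral_geometric (q := fun y => y ^ 2 * (1 - y ^ 2) ^ 2 / 2)
    (h := fun y => h y) (by fun_prop) (fun y _ => by positivity) (fun y hy => by
      have h0 : 0 ≤ y ^ 2 := sq_nonneg y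
      have h1 : y ^ 2 ≤ 1 := pow_le_one₀ hy.1 hy.2
      have h2 : (1 - y ^ 2) ^ 2 ≤ 1 := pow_le_one₀ (by linarith) (by linarith)
      nlinarith [mul_le_one₀ h1 (sq_nonneg (1 - y ^ 2)) h2]) hh).mul_left (1 / 2)
  refine key.of_eq (fun n => ?_) ?_
  · rw [← integral_const_mul, ← integral_const_mul]
    congr 1; ext y
    rw [show y ^ 2 * (1 - y ^ 2) ^ 2 / 2 = 1 / 2 * (y ^ 2 * (1 - y ^ 2) ^ 2) by ring, mul_pow,
      mul_pow, pow_mul, pow_mul, pow_succ]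
    ring
  · rw [← integral_const_mul]
    refine integral_congr fun y hy => ?_
    rw [Set.uIcc_of_le zero_le_one] at hy
    have h1 := two_sub_sq_pos hy
    have h2 : 0 < 1 + y ^ 4 := by positivity
    have e : 1 - y ^ 2 * (1 - y ^ 2) ^ 2 / 2 = (2 - y ^ 2) * (1 + y ^ 4) / 2 := by ring
    simp only [e]
    field_simp

/-- `∫₀¹ h(y) / (2 - y²) dy`. -/
noncomputable def intTwoSub (h : ℝ → ℝ) : ℝ := ∫ y in (0 : ℝ)..1, h y / (2 - y ^ 2)

/-- `∫₀¹ h(y) / (1 + y⁴) dy`. -/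
noncomputable def intQuartic (h : ℝ → ℝ) : ℝ := ∫ y in (0 : ℝ)..1, h y / (1 + y ^ 4)

/-- `∫₀¹ y² h(y) / (1 + y⁴) dy`. -/
noncomputable def intSqQuartic (h : ℝ → ℝ) : ℝ := ∫ y in (0 : ℝ)..1, y ^ 2 * h y / (1 + y ^ 4)

theorem continuousOn_inv_two_sub_sq :
    ContinuousOn (fun y : ℝ => (2 - y ^ 2)⁻¹) (Set.uIcc 0 1) := by
  refine ContinuousOn.inv₀ (by fun_prop) fun y hy => ?_
  rw [Set.uIcc_of_le zero_le_one] at hy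
  exact (two_sub_sq_pos hy).ne'

theorem continuous_inv_one_add_pow_four : Continuous (fun y : ℝ => (1 + y ^ 4)⁻¹) :=
  Continuous.inv₀ (by fun_prop) fun y => by positivity

theorem intervalIntegrable_div_two_sub_sq {h : ℝ → ℝ}
    (hh : IntervalIntegrable h volume 0 1) :
    IntervalIntegrable (fun y => h y / (2 - y ^ 2)) volume 0 1 := by
  simpa only [div_eq_mul_inv] using hh.mul_continuousOn continuousOn_inv_two_sub_sq

theorem intervalIntegrable_div_one_add_pow_four {h : ℝ → ℝ}
    (hh : IntervalIntegrable h volume 0 1) :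
    IntervalIntegrable (fun y => h y / (1 + y ^ 4)) volume 0 1 := by
  simpa only [div_eq_mul_inv] using
    hh.mul_continuousOn continuous_inv_one_add_pow_four.continuousOn

theorem intervalIntegrable_sq_mul_div_one_add_pow_four {h : ℝ → ℝ}
    (hh : IntervalIntegrable h volume 0 1) :
    IntervalIntegrable (fun y => y ^ 2 * h y / (1 + y ^ 4)) volume 0 1 :=
  intervalIntegrable_div_one_add_pow_four (hh.continuousOn_mul (by fun_prop))

/-- Applied with p = (1-y²)², 4y²(1-y²) and 1-3y², for the denominators 2k-1, k and (2k-1)²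
respectively. -/
theorem integral_partial_fractions {h : ℝ → ℝ}
    (hh : IntervalIntegrable h volume 0 1) (p : ℝ → ℝ) (a b c : ℝ)
    (hp : ∀ y : ℝ, p y = a * (1 + y ^ 4) + (b + c * y ^ 2) * (2 - y ^ 2)) :
    ∫ y in (0 : ℝ)..1, p y * h y / ((2 - y ^ 2) * (1 + y ^ 4)) =
      a * intTwoSub h + b * intQuartic h + c * intSqQuartic h := by
  have i0 := intervalIntegrable_div_two_sub_sq hh
  have i1 := intervalIntegrable_div_one_add_pow_four hh
  have i2 := intervalIntegrable_sq_mul_div_one_add_pow_four hh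
  rw [intTwoSub, intQuartic, intSqQuartic, ← integral_const_mul, ← integral_const_mul,
    ← integral_const_mul, ← integral_add (i0.const_mul a) (i1.const_mul b),
    ← integral_add ((i0.const_mul a).add (i1.const_mul b)) (i2.const_mul c)]
  refine integral_congr fun y hy => ?_
  rw [Set.uIcc_of_le zero_le_one] at hy
  have h1 := (two_sub_sq_pos hy).ne'
  have h2 : 1 + y ^ 4 ≠ 0 := by positivity
  simp only [hp]
  field_simp
  ring

theorem hasSum_integral_first {h : ℝ → ℝ}
    (hh : IntervalIntegrable h volume 0 1) :
    HasSum (fun n : ℕ => (1 / 2 : ℝ) ^ (n + 1) *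
        ∫ y in (0 : ℝ)..1, y ^ (2 * n) * (1 - y ^ 2) ^ (2 * n + 2) * h y)
      ((intTwoSub h + 2 * intQuartic h - 4 * intSqQuartic h) / 5) := by
  have k := hasSum_integral_kernel (h := fun y => (1 - y ^ 2) ^ 2 * h y)
    (hh.continuousOn_mul (by fun_prop))
  rw [integral_partial_fractions hh _ (1 / 5) (2 / 5) (-4 / 5) (fun y => by ring)] at k
  refine k.of_eq (fun n => ?_) ?_
  · congr 2; ext y; ring
  · ring

theorem hasSum_integral_second {h : ℝ → ℝ}
    (hh : IntervalIntegrable h volume 0 1) :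
    HasSum (fun n : ℕ => 4 * (1 / 2 : ℝ) ^ (n + 1) *
        ∫ y in (0 : ℝ)..1, y ^ (2 * (n + 1)) * (1 - y ^ 2) ^ (2 * n + 1) * h y)
      (4 / 5 * (-2 * intTwoSub h + intQuartic h + 3 * intSqQuartic h)) := by
  have k := hasSum_integral_kernel (h := fun y => (4 * y ^ 2 * (1 - y ^ 2)) * h y)
    (hh.continuousOn_mul (by fun_prop))
  rw [integral_partial_fractions hh _ (-8 / 5) (4 / 5) (12 / 5) (fun y => by ring)] at k
  refine k.of_eq (fun n => ?_) ?_
  · rw [mul_comm (4 : ℝ), mul_assoc, ← integral_const_mul]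
    congr 2; ext y; ring
  · ring

theorem hasSum_integral_third {h : ℝ → ℝ}
    (hh : IntervalIntegrable h volume 0 1) :
    HasSum (fun n : ℕ => (1 / 2 : ℝ) ^ (n + 1) *
        ∫ y in (0 : ℝ)..1, y ^ (2 * n) * (1 - y ^ 2) ^ (2 * n) * ((1 - 3 * y ^ 2) * h y))
      (-intTwoSub h + intQuartic h - intSqQuartic h) := by
  have k := hasSum_integral_kernel (h := fun y => (1 - 3 * y ^ 2) * h y)
    (hh.continuousOn_mul (by fun_prop))
  rw [integral_partial_fractions hh _ (-1) 1 (-1) (fun y => by ring)] at k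
  exact k.of_eq (fun n => rfl) (by ring)

/-! ### Binomial coefficients as beta values. -/

theorem binomFactor_eq (k : ℕ) : binomFactor k =
    8 ^ k * ((2 * k).factorial : ℝ) ^ 2 * (3 * k).factorial / (k.factorial * (6 * k).factorial) := by
  rw [binomFactor, Nat.cast_choose ℝ (by lia : k ≤ 2 * k), Nat.cast_choose ℝ (by lia : k ≤ 3 * k),
    Nat.cast_choose ℝ (by lia : 3 * k ≤ 6 * k), show 2 * k - k = k by lia,
    show 3 * k - k = 2 * k by lia, show 6 * k - 3 * k = 3 * k by lia]
  have h1 : (k.factorial : ℝ) ≠ 0 := by positivity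
  have h2 : ((2 * k).factorial : ℝ) ≠ 0 := by positivity
  have h3 : ((3 * k).factorial : ℝ) ≠ 0 := by positivity
  have h6 : ((6 * k).factorial : ℝ) ≠ 0 := by positivity
  field_simp

theorem evenBeta_first (n : ℕ) : (1 / 2 : ℝ) ^ (n + 1) * evenBeta n (2 * n + 2) =
    binomFactor (n + 1) / (2 * n + 1) := by
  rw [binomFactor_eq, evenBeta, show n + (2 * n + 2) + 1 = 3 * (n + 1) by ring,
    show 2 * n + 2 * (2 * n + 2) + 2 = 6 * (n + 1) by ring,
    show 2 * (n + 1) = 2 * n + 1 + 1 by ring, show 2 * n + 2 = 2 * n + 1 + 1 by ring]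
  have h8 : (8 : ℝ) ^ (n + 1) = 2 ^ (3 * (n + 1)) := by rw [pow_mul]; norm_num
  simp only [Nat.factorial_succ n, Nat.factorial_succ (2 * n), Nat.factorial_succ (2 * n + 1)]
  have h1 : (n.factorial : ℝ) ≠ 0 := by positivity
  have h2 : ((2 * n).factorial : ℝ) ≠ 0 := by positivity
  have h3 : ((3 * (n + 1)).factorial : ℝ) ≠ 0 := by positivity
  have h6 : ((6 * (n + 1)).factorial : ℝ) ≠ 0 := by positivity
  have h4 : (2 * (n : ℝ) + 1) ≠ 0 := by positivity
  have h5 : ((n : ℝ) + 1) ≠ 0 := by positivity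
  rw [h8, one_div, inv_pow]
  push_cast
  field_simp
  ring

theorem evenBeta_second (n : ℕ) : 4 * (1 / 2 : ℝ) ^ (n + 1) * evenBeta (n + 1) (2 * n + 1) =
    binomFactor (n + 1) / (n + 1) := by
  have h := evenBeta_first n
  rw [evenBeta_succ_eq_mul, show 2 * n + 1 + 1 = 2 * n + 2 by ring]
  have h4 : (2 * (n : ℝ) + 1) ≠ 0 := by positivity
  have h5 : ((n : ℝ) + 1) ≠ 0 := by positivity
  rw [eq_div_iff h4] at h
  rw [← h]
  push_cast
  field_simp
  ring

/-- The weight comes from integration by parts: (2n+1) y^(2n)(1-y²)^(2n)(1-3y²) is the derivative of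
(y-y³)^(2n+1), and y²/2 - log y has derivative -(1-y²)/y, so a second factor 1/(2n+1) multiplies the
integral of `evenBeta_first`. The proof verifies this through the beta values. -/
theorem evenBeta_third (n : ℕ) :
    (1 / 2 : ℝ) ^ (n + 1) * ∫ y in (0 : ℝ)..1, y ^ (2 * n) * (1 - y ^ 2) ^ (2 * n) *
      ((1 - 3 * y ^ 2) * (y ^ 2 / 2 - Real.log y)) = binomFactor (n + 1) / (2 * n + 1) ^ 2 := by
  have il : ∀ m N : ℕ, IntervalIntegrable (fun y : ℝ => y ^ (2 * m) * (1 - y ^ 2) ^ N * Real.log y)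
      volume 0 1 := fun m N => intervalIntegrable_log'.continuousOn_mul (by fun_prop)
  have ip : ∀ m N : ℕ, IntervalIntegrable (fun y : ℝ => y ^ (2 * m) * (1 - y ^ 2) ^ N)
      volume 0 1 := fun m N => Continuous.intervalIntegrable (by fun_prop) _ _
  have e : ∫ y in (0 : ℝ)..1, y ^ (2 * n) * (1 - y ^ 2) ^ (2 * n) *
      ((1 - 3 * y ^ 2) * (y ^ 2 / 2 - Real.log y)) =
      1 / 2 * evenBeta (n + 1) (2 * n) - 3 / 2 * evenBeta (n + 2) (2 * n)
      + evenBeta n (2 * n) * (oddHarmonic (3 * n + 1) - oddHarmonic n)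
      - 3 * (evenBeta (n + 1) (2 * n) * (oddHarmonic (3 * n + 2) - oddHarmonic (n + 1))) := by
    have l1 := integral_evenBeta_log n (2 * n)
    have l2 := integral_evenBeta_log (n + 1) (2 * n)
    rw [show n + 2 * n + 1 = 3 * n + 1 by ring] at l1
    rw [show n + 1 + 2 * n + 1 = 3 * n + 2 by ring] at l2
    have l1' := neg_eq_iff_eq_neg.mpr l1
    have l2' := neg_eq_iff_eq_neg.mpr l2
    rw [← l1', ← l2', ← integral_evenBeta, ← integral_evenBeta, ← integral_const_mul,
      ← integral_const_mul, mul_neg, sub_neg_eq_add, ← integral_const_mul, ← sub_eq_add_neg,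
      ← integral_sub ((ip _ _).const_mul _) ((ip _ _).const_mul _),
      ← integral_sub (((ip _ _).const_mul _).sub ((ip _ _).const_mul _)) (il _ _),
      ← integral_add ((((ip _ _).const_mul _).sub ((ip _ _).const_mul _)).sub (il _ _))
        ((il _ _).const_mul _)]
    congr 1; ext y; ring
  rw [e]
  have h := evenBeta_first n
  have h4 : (2 * (n : ℝ) + 1) ≠ 0 := by positivity
  have h5 : ((n : ℝ) + 1) ≠ 0 := by positivity
  have h6 : (6 * (n : ℝ) + 3) ≠ 0 := by positivity
  have h7 : (6 * (n : ℝ) + 5) ≠ 0 := by positivity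
  have h8 : (2 * (3 * (n : ℝ) + 1) + 1) ≠ 0 := by positivity
  rw [eq_div_iff h4] at h
  -- Every beta value is brought to `evenBeta n (2 * n + 2)`, the one known from `evenBeta_first`.
  have r1 := evenBeta_eq_mul_succ n (2 * n)
  have r2 := evenBeta_eq_mul_succ n (2 * n + 1)
  have r3 := evenBeta_succ_eq_mul n (2 * n)
  have r4 := evenBeta_succ_eq_mul (n + 1) (2 * n)
  have r5 := evenBeta_succ_eq_mul n (2 * n + 1)
  rw [show 2 * n + 1 + 1 = 2 * n + 2 by ring] at r2 r5
  rw [r4, r5, r3, r1, r2, ← h, show 3 * n + 2 = 3 * n + 1 + 1 by ring, oddHarmonic_succ (3 * n + 1),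
    oddHarmonic_succ n]
  push_cast
  field_simp
  ring

/-! ### The complex dilogarithm: derivative, power series, integral forms. -/

/-- The dilogarithm `Li₂(z) = -∫₀¹ log(1 - t z) dt / t`. -/
noncomputable def dilog (z : ℂ) : ℂ := ∫ t in (0 : ℝ)..1, -(Complex.log (1 - t * z) / t)

theorem one_sub_mul_mem_slitPlane {z : ℂ} (hz : 1 - z ∈ Complex.slitPlane) {t : ℝ}
    (ht : t ∈ Set.Icc (0 : ℝ) 1) : 1 - (t : ℂ) * z ∈ Complex.slitPlane := by
  rw [Complex.mem_slitPlane_iff] at hz ⊢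
  simp only [Complex.sub_re, Complex.one_re, Complex.mul_re, Complex.ofReal_re, Complex.ofReal_im,
    zero_mul, sub_zero, Complex.sub_im, Complex.one_im, Complex.mul_im, zero_sub, neg_ne_zero,
    add_zero] at hz ⊢
  rcases ht.1.eq_or_lt with h0 | h0
  · left; rw [← h0]; norm_num
  rcases hz with h | h
  · left; nlinarith [ht.1, ht.2]
  · right; exact mul_ne_zero h0.ne' h

theorem hasDerivAt_log_one_sub_mul {z : ℂ} {t : ℝ} (h : 1 - (t : ℂ) * z ∈ Complex.slitPlane) :
    HasDerivAt (fun s : ℝ => Complex.log (1 - (s : ℂ) * z)) (-z / (1 - t * z)) t := by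
  have h1 : HasDerivAt (fun s : ℂ => 1 - s * z) (-z) (t : ℂ) := by
    simpa using ((hasDerivAt_id (t : ℂ)).mul_const z).const_sub 1
  exact (h1.clog h).comp_ofReal

/-- The singularity of log(1-tz)/t at t = 0 is removable, and `dslope` is its continuous extension.
-/
theorem continuousOn_dslope_log_one_sub_mul {z : ℂ} (hz : 1 - z ∈ Complex.slitPlane) :
    ContinuousOn (dslope (fun s : ℝ => Complex.log (1 - (s : ℂ) * z)) 0) (Set.Icc 0 1) := by
  have ho : IsOpen {t : ℝ | 1 - (t : ℂ) * z ∈ Complex.slitPlane} :=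
    Complex.isOpen_slitPlane.preimage (by fun_prop)
  have h0 : (0 : ℝ) ∈ {t : ℝ | 1 - (t : ℂ) * z ∈ Complex.slitPlane} := by simp
  have hsub : Set.Icc (0 : ℝ) 1 ⊆ {t : ℝ | 1 - (t : ℂ) * z ∈ Complex.slitPlane} :=
    fun t ht => one_sub_mul_mem_slitPlane hz ht
  refine ContinuousOn.mono ?_ hsub
  rw [continuousOn_dslope (ho.mem_nhds h0)]
  exact ⟨fun t ht => (hasDerivAt_log_one_sub_mul ht).continuousAt.continuousWithinAt,
    (hasDerivAt_log_one_sub_mul h0).differentiableAt⟩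

theorem intervalIntegrable_dilog {z : ℂ} (hz : 1 - z ∈ Complex.slitPlane) :
    IntervalIntegrable (fun t : ℝ => -(Complex.log (1 - t * z) / t)) volume 0 1 := by
  have h := continuousOn_dslope_log_one_sub_mul hz
  rw [← Set.uIcc_of_le zero_le_one] at h
  refine h.intervalIntegrable.neg.congr_uIoo ?_
  intro t ht
  rw [Set.uIoo_of_le zero_le_one] at ht
  simp only [Pi.neg_apply]
  rw [dslope_of_ne _ ht.1.ne', slope_def_module]
  simp [div_eq_inv_mul]

/-- Differentiation under the integral sign. Leaving the derivative as an integral includes z = 0,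
hence continuity there. -/
theorem hasDerivAt_dilog_integral {z : ℂ} (hz : 1 - z ∈ Complex.slitPlane) :
    HasDerivAt dilog (∫ t in (0 : ℝ)..1, 1 / (1 - t * z)) z := by
  have ho : IsOpen {w : ℂ | 1 - w ∈ Complex.slitPlane} :=
    Complex.isOpen_slitPlane.preimage (by fun_prop)
  -- A closed ball, so that compactness gives a constant dominating the derivative.
  obtain ⟨ε, hε, hball⟩ := Metric.nhds_basis_closedBall.mem_iff.mp (ho.mem_nhds hz)
  have hne : ∀ p ∈ Set.Icc (0 : ℝ) 1 ×ˢ Metric.closedBall z ε, 1 - (p.1 : ℂ) * p.2 ≠ 0 :=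
    fun p hp => Complex.slitPlane_ne_zero (one_sub_mul_mem_slitPlane (hball hp.2) hp.1)
  have hcont : ContinuousOn (fun p : ℝ × ℂ => 1 / (1 - (p.1 : ℂ) * p.2))
      (Set.Icc (0 : ℝ) 1 ×ˢ Metric.closedBall z ε) :=
    ContinuousOn.div (by fun_prop) (by fun_prop) hne
  obtain ⟨C, hC⟩ := (isCompact_Icc.prod (isCompact_closedBall z ε)).exists_bound_of_continuousOn hcont
  refine (hasDerivAt_integral_of_dominated_loc_of_deriv_le (μ := volume) (bound := fun _ => C)
    (F := fun (w : ℂ) (t : ℝ) => -(Complex.log (1 - t * w) / t))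
    (F' := fun (w : ℂ) (t : ℝ) => 1 / (1 - t * w))
    (Metric.closedBall_mem_nhds z hε) ?_ (intervalIntegrable_dilog hz) ?_ ?_ ?_ ?_).2
  · exact Filter.Eventually.of_forall fun w => by
      apply Measurable.aestronglyMeasurable
      fun_prop
  · apply Measurable.aestronglyMeasurable
    fun_prop
  · refine Filter.Eventually.of_forall fun t ht w hw => ?_
    rw [Set.uIoc_of_le zero_le_one] at ht
    exact hC (t, w) ⟨⟨ht.1.le, ht.2⟩, hw⟩
  · exact intervalIntegrable_const
  · refine Filter.Eventually.of_forall fun t ht w hw => ?_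
    rw [Set.uIoc_of_le zero_le_one] at ht
    have hm := one_sub_mul_mem_slitPlane (hball hw) (⟨ht.1.le, ht.2⟩ : t ∈ Set.Icc (0 : ℝ) 1)
    have h1 : HasDerivAt (fun s : ℂ => 1 - (t : ℂ) * s) (-t) w := by
      simpa using ((hasDerivAt_id w).const_mul (t : ℂ)).const_sub 1
    refine ((h1.clog hm).div_const (t : ℂ)).neg.congr_deriv ?_
    have ht0 : (t : ℂ) ≠ 0 := by exact_mod_cast ht.1.ne'
    have := Complex.slitPlane_ne_zero hm
    field_simp

theorem continuousAt_dilog {z : ℂ} (hz : 1 - z ∈ Complex.slitPlane) : ContinuousAt dilog z :=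
  (hasDerivAt_dilog_integral hz).continuousAt

theorem hasDerivAt_dilog {z : ℂ} (hz : 1 - z ∈ Complex.slitPlane) (h0 : z ≠ 0) :
    HasDerivAt dilog (-(Complex.log (1 - z) / z)) z := by
  refine (hasDerivAt_dilog_integral hz).congr_deriv ?_
  rw [integral_eq_sub_of_hasDerivAt (f := fun t : ℝ => -(Complex.log (1 - t * z) / z))]
  · simp
  · intro t ht
    rw [Set.uIcc_of_le zero_le_one] at ht
    have hm := one_sub_mul_mem_slitPlane hz ht
    refine ((hasDerivAt_log_one_sub_mul hm).div_const z).neg.congr_deriv ?_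
    have := Complex.slitPlane_ne_zero hm
    field_simp
  · apply ContinuousOn.intervalIntegrable
    rw [Set.uIcc_of_le zero_le_one]
    exact ContinuousOn.div (by fun_prop) (by fun_prop) fun t ht =>
      Complex.slitPlane_ne_zero (one_sub_mul_mem_slitPlane hz ht)

/-- With each term split into a complex constant and a nonnegative function, the L¹ norms are ‖c n‖
∫ g n. Only the open interval matters, so endpoint singularities are harmless. -/
theorem hasSum_integral_mul {c : ℕ → ℂ} {g : ℕ → ℝ → ℝ} {f : ℝ → ℂ}
    (hg : ∀ n, IntervalIntegrable (g n) volume 0 1)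
    (hg0 : ∀ n, ∀ t ∈ Set.Ioo (0 : ℝ) 1, 0 ≤ g n t)
    (hs : Summable fun n => ‖c n‖ * ∫ t in (0 : ℝ)..1, g n t)
    (hf : ∀ t ∈ Set.Ioo (0 : ℝ) 1, HasSum (fun n => c n * (g n t : ℂ)) (f t)) :
    HasSum (fun n => c n * ((∫ t in (0 : ℝ)..1, g n t : ℝ) : ℂ)) (∫ t in (0 : ℝ)..1, f t) := by
  have key := MeasureTheory.hasSum_integral_of_summable_integral_norm
    (μ := volume.restrict (Set.Ioo (0 : ℝ) 1)) (F := fun n t => c n * (g n t : ℂ)) ?_ ?_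
  · have e1 : ∀ n, ∫ t in Set.Ioo (0 : ℝ) 1, c n * (g n t : ℂ) =
        c n * ((∫ t in (0 : ℝ)..1, g n t : ℝ) : ℂ) := fun n => by
      rw [← integral_ofReal, ← intervalIntegral.integral_const_mul, integral_of_le zero_le_one,
        MeasureTheory.integral_Ioc_eq_integral_Ioo]
    have e2 : ∫ t in Set.Ioo (0 : ℝ) 1, ∑' n, c n * (g n t : ℂ) = ∫ t in (0 : ℝ)..1, f t := by
      rw [integral_of_le zero_le_one, MeasureTheory.integral_Ioc_eq_integral_Ioo]
      exact MeasureTheory.setIntegral_congr_fun measurableSet_Ioo fun t ht => (hf t ht).tsum_eq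
    simp only [e1, e2] at key
    exact key
  · intro n
    have := hg n
    rw [intervalIntegrable_iff_integrableOn_Ioo_of_le zero_le_one] at this
    exact this.ofReal.const_mul _
  · refine hs.congr fun n => ?_
    rw [integral_of_le zero_le_one, MeasureTheory.integral_Ioc_eq_integral_Ioo,
      ← MeasureTheory.integral_const_mul]
    refine MeasureTheory.setIntegral_congr_fun measurableSet_Ioo fun t ht => ?_
    simp [abs_of_nonneg (hg0 n t ht)]

/-- Termwise integration reaches the whole unit circle because the integrated norms are at most
1/n². -/
theorem hasSum_dilog {z : ℂ} (hz : ‖z‖ ≤ 1) : HasSum (fun n : ℕ => z ^ n / (n : ℂ) ^ 2) (dilog z) := by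
  have hval : ∀ n : ℕ, n ≠ 0 → ∫ t in (0 : ℝ)..1, t ^ (n - 1) = 1 / (n : ℝ) := fun n hn => by
    rw [integral_pow, Nat.sub_add_cancel (Nat.one_le_iff_ne_zero.mpr hn)]
    simp [hn, Nat.cast_sub (Nat.one_le_iff_ne_zero.mpr hn)]
  -- For n = 0 the coefficient is z⁰/0 = 0, so the truncated exponent n - 1 does no harm.
  have key := hasSum_integral_mul (c := fun n : ℕ => z ^ n / (n : ℂ))
    (g := fun n t => t ^ (n - 1)) (f := fun t : ℝ => -(Complex.log (1 - t * z) / t))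
    (fun n => Continuous.intervalIntegrable (by fun_prop) _ _)
    (fun n t ht => pow_nonneg ht.1.le _) ?_ ?_
  · refine key.congr_fun fun n => ?_
    rcases eq_or_ne n 0 with rfl | hn
    · simp
    · have : (n : ℂ) ≠ 0 := by exact_mod_cast hn
      rw [hval n hn]
      push_cast
      field_simp
  · refine Summable.of_nonneg_of_le (fun n => mul_nonneg (norm_nonneg _) ?_) (fun n => ?_)
      (Real.summable_one_div_nat_pow.mpr one_lt_two)
    · exact integral_nonneg zero_le_one fun t ht => pow_nonneg ht.1 _
    · rcases eq_or_ne n 0 with rfl | hn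
      · simp
      · have hn' : (0 : ℝ) < n := by positivity
        rw [hval n hn, norm_div, norm_pow, Complex.norm_natCast, div_mul_div_comm, mul_one, ← sq]
        gcongr
        exact pow_le_one₀ (norm_nonneg _) hz
  · intro t ht
    have h1 : ‖(t : ℂ) * z‖ < 1 := by
      rw [norm_mul, Complex.norm_real, Real.norm_of_nonneg ht.1.le]
      nlinarith [ht.1, ht.2, norm_nonneg z]
    have := ((Complex.hasSum_taylorSeries_neg_log h1).div_const (t : ℂ))
    rw [neg_div] at this
    refine this.congr_fun fun n => ?_
    have ht0 : (t : ℂ) ≠ 0 := by exact_mod_cast ht.1.ne'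
    rcases eq_or_ne n 0 with rfl | hn
    · simp
    · obtain ⟨m, rfl⟩ := Nat.exists_eq_succ_of_ne_zero hn
      simp only [Nat.succ_eq_add_one, Nat.add_sub_cancel, Complex.ofReal_pow, mul_pow, pow_succ (t : ℂ)]
      field_simp

/-- Expand z/(1-tz) geometrically and use ∫ tⁿ log t = -1/(n+1)². The integrals of log y below
reduce to this form. -/
theorem integral_log_mul_div_one_sub {z : ℂ} (hz : ‖z‖ ≤ 1) :
    ∫ t in (0 : ℝ)..1, (Real.log t : ℂ) * (z / (1 - t * z)) = -dilog z := by
  have key := hasSum_integral_mul (c := fun n : ℕ => -z ^ (n + 1))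
    (g := fun n t => -(t ^ n * Real.log t)) (f := fun t : ℝ => (Real.log t : ℂ) * (z / (1 - t * z)))
    (fun n => (intervalIntegrable_log'.continuousOn_mul (by fun_prop)).neg)
    (fun n t ht => by
      have := Real.log_nonpos ht.1.le ht.2.le
      have := pow_nonneg ht.1.le n
      nlinarith) ?_ ?_
  · have h2 := (hasSum_nat_add_iff' 1).mpr (hasSum_dilog hz)
    simp only [Finset.range_one, Finset.sum_singleton, Nat.cast_zero, ne_eq, OfNat.ofNat_ne_zero,
      not_false_eq_true, zero_pow, div_zero, sub_zero] at h2
    refine key.unique (h2.neg.congr_fun fun n => ?_)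
    rw [intervalIntegral.integral_neg, integral_pow_mul_log]
    push_cast
    ring
  · have hs := (summable_nat_add_iff 1).mpr (Real.summable_one_div_nat_pow.mpr one_lt_two)
    refine Summable.of_nonneg_of_le (fun n => mul_nonneg (norm_nonneg _) ?_) (fun n => ?_) hs
    · rw [intervalIntegral.integral_neg, integral_pow_mul_log]
      simp only [neg_neg]
      positivity
    · rw [intervalIntegral.integral_neg, integral_pow_mul_log, neg_neg, norm_neg, norm_pow]
      push_cast
      exact mul_le_of_le_one_left (by positivity) (pow_le_one₀ (norm_nonneg _) hz)
  · intro t ht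
    have h1 : ‖(t : ℂ) * z‖ < 1 := by
      rw [norm_mul, Complex.norm_real, Real.norm_of_nonneg ht.1.le]
      nlinarith [ht.1, ht.2, norm_nonneg z]
    have := (hasSum_geometric_of_norm_lt_one h1).mul_left ((Real.log t : ℂ) * z)
    rw [mul_assoc, ← div_eq_mul_inv] at this
    refine this.congr_fun fun n => ?_
    push_cast
    ring

/-! ### Generalized polylogarithms as integrals of the principal logarithm. -/

theorem GPL_singleton {z : ℂ} (hz0 : z ≠ 0) (hz : 1 - z ∈ Complex.slitPlane) {t : ℝ}
    (ht : t ∈ Set.Icc (0 : ℝ) 1) : GPL [z⁻¹] t = Complex.log (1 - t * z) := by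
  have hn : ¬ ∀ α ∈ [z⁻¹], α = 0 := by simpa using hz0
  rw [GPL, if_neg hn]
  have hw := one_sub_mul_mem_slitPlane hz ht
  rw [integral_eq_sub_of_hasDerivAt (f := fun s : ℝ => Complex.log (1 - s * ((t : ℂ) * z)))]
  · simp
  · intro s hs
    rw [Set.uIcc_of_le zero_le_one] at hs
    have hm := one_sub_mul_mem_slitPlane hw hs
    refine (hasDerivAt_log_one_sub_mul hm).congr_deriv ?_
    have h1 := Complex.slitPlane_ne_zero hm
    have h2 : (s : ℂ) * t - z⁻¹ ≠ 0 := by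
      intro h
      apply h1
      have : ((s : ℂ) * t - z⁻¹) * z = 0 := by rw [h, zero_mul]
      rw [sub_mul, inv_mul_cancel₀ hz0] at this
      linear_combination -this
    rw [GPL, mul_one, div_eq_div_iff h1 h2]
    field_simp
    ring
  · apply ContinuousOn.intervalIntegrable
    simp only [GPL, mul_one]
    refine ContinuousOn.div (by fun_prop) (by fun_prop) fun s hs => ?_
    rw [Set.uIcc_of_le zero_le_one] at hs
    have h1 := Complex.slitPlane_ne_zero (one_sub_mul_mem_slitPlane hw hs)
    intro h
    apply h1
    have : ((s : ℂ) * t - z⁻¹) * z = 0 := by rw [h, zero_mul]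
    rw [sub_mul, inv_mul_cancel₀ hz0] at this
    linear_combination -this

theorem MPL_two {z : ℂ} (hz0 : z ≠ 0) (hz : 1 - z ∈ Complex.slitPlane) :
    MPL [(2, z)] = dilog z := by
  have e : mplWord 1 [(2, z)] = [0, z⁻¹] := by simp [mplWord]
  have hn : ¬ ∀ α ∈ [0, z⁻¹], α = 0 := by simpa using hz0
  rw [MPL, e, GPL, if_neg hn, dilog, List.length_singleton, pow_one, neg_one_mul,
    ← intervalIntegral.integral_neg]
  refine integral_congr fun t ht => ?_
  rw [Set.uIcc_of_le zero_le_one] at ht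
  simp only [mul_one, sub_zero]
  rw [GPL_singleton hz0 hz ht]
  ring

theorem MPL_one_one {z w : ℂ} (hz0 : z ≠ 0) (hw0 : w ≠ 0)
    (hw : 1 - z * w ∈ Complex.slitPlane) :
    MPL [(1, z), (1, w)] = ∫ t in (0 : ℝ)..1, Complex.log (1 - t * (z * w)) / (t - z⁻¹) := by
  have e : mplWord 1 [(1, z), (1, w)] = [z⁻¹, (z * w)⁻¹] := by simp [mplWord]
  have hn : ¬ ∀ α ∈ [z⁻¹, (z * w)⁻¹], α = 0 := by simp [hz0]
  rw [MPL, e, GPL, if_neg hn]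
  simp only [List.length_cons, List.length_nil, zero_add, Nat.reduceAdd, even_two, Even.neg_pow,
    one_pow, one_mul, mul_one]
  refine integral_congr fun t ht => ?_
  rw [Set.uIcc_of_le zero_le_one] at ht
  rw [GPL_singleton (mul_ne_zero hz0 hw0) hw ht]
  ring

/-! ### Dilogarithms at eighth roots of unity. -/

theorem theta_eq : theta = ((√2 / 2 : ℝ) : ℂ) + ((√2 / 2 : ℝ) : ℂ) * Complex.I := by
  rw [theta, show (Real.pi * Complex.I / 4 : ℂ) = ((Real.pi / 4 : ℝ) : ℂ) * Complex.I by
    push_cast; ring, Complex.exp_mul_I, ← Complex.ofReal_cos, ← Complex.ofReal_sin,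
    Real.cos_pi_div_four, Real.sin_pi_div_four]

theorem theta_re : theta.re = √2 / 2 := by simp [theta_eq]
theorem theta_im : theta.im = √2 / 2 := by simp [theta_eq]

theorem theta_sq : theta ^ 2 = Complex.I := by
  rw [theta, ← Complex.exp_nat_mul]
  rw [show ((2 : ℕ) : ℂ) * (Real.pi * Complex.I / 4) = Real.pi / 2 * Complex.I by push_cast; ring,
    Complex.exp_pi_div_two_mul_I]

theorem norm_theta : ‖theta‖ = 1 := by
  rw [theta, show (Real.pi * Complex.I / 4 : ℂ) = ((Real.pi / 4 : ℝ) : ℂ) * Complex.I by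
    push_cast; ring, Complex.norm_exp_ofReal_mul_I]

theorem theta_ne_zero : theta ≠ 0 := by
  rw [← norm_ne_zero_iff, norm_theta]; exact one_ne_zero

theorem one_sub_mem_slitPlane_of_im {z : ℂ} (h : z.im ≠ 0) : 1 - z ∈ Complex.slitPlane := by
  rw [Complex.mem_slitPlane_iff]; right; simpa using h

theorem sqrt_two_ne_zero : √(2 : ℝ) ≠ 0 := by positivity

theorem imLi2_eq : imLi2 = (dilog theta).im := by
  rw [imLi2, MPL_two theta_ne_zero (one_sub_mem_slitPlane_of_im (by rw [theta_im]; positivity))]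

theorem catalanG_eq : catalanG = (dilog Complex.I).im := by
  rw [catalanG, MPL_two Complex.I_ne_zero (one_sub_mem_slitPlane_of_im (by simp))]

theorem dilog_add_dilog_neg {z : ℂ} (hz : ‖z‖ ≤ 1) :
    dilog z + dilog (-z) = dilog (z ^ 2) / 2 := by
  have h1 := (hasSum_dilog hz).add (hasSum_dilog (z := -z) (by rwa [norm_neg]))
  have h2 := (hasSum_dilog (z := z ^ 2) (by rw [norm_pow]; exact pow_le_one₀ (norm_nonneg _) hz))
  have h3 : HasSum (fun n : ℕ => z ^ n / (n : ℂ) ^ 2 + (-z) ^ n / (n : ℂ) ^ 2)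
      (dilog (z ^ 2) / 2 + 0) := by
    apply HasSum.even_add_odd
    · refine (h2.div_const 2).congr_fun fun n => ?_
      rw [pow_mul, pow_mul, neg_sq]
      push_cast
      ring
    · refine (hasSum_zero (α := ℂ) (β := ℕ)).congr_fun fun n => ?_
      rw [Odd.neg_pow (by simp)]
      ring
  rw [h1.unique h3, add_zero]

/-- The real part is the cosine series Σ cos(2πnx)/n², which is the Fourier series of the Bernoulli
polynomial B₂. -/
theorem re_dilog_exp {x : ℝ} (hx : x ∈ Set.Icc (0 : ℝ) 1) :
    (dilog (Complex.exp ((2 * Real.pi * x : ℝ) * Complex.I))).re =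
      Real.pi ^ 2 * (x ^ 2 - x + 1 / 6) := by
  have h1 := hasSum_dilog (z := Complex.exp ((2 * Real.pi * x : ℝ) * Complex.I))
    (by rw [Complex.norm_exp_ofReal_mul_I])
  have h2 := Complex.hasSum_re h1
  have h3 := hasSum_one_div_nat_pow_mul_cos (k := 1) one_ne_zero hx
  have e : ∀ n : ℕ, (Complex.exp ((2 * Real.pi * x : ℝ) * Complex.I) ^ n / (n : ℂ) ^ 2).re =
      1 / (n : ℝ) ^ (2 * 1) * Real.cos (2 * Real.pi * n * x) := fun n => by
    rw [← Complex.exp_nat_mul, show ((n : ℂ) * ((2 * Real.pi * x : ℝ) * Complex.I)) =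
      ((2 * Real.pi * n * x : ℝ) : ℂ) * Complex.I by push_cast; ring,
      show ((n : ℂ) ^ 2) = (((n : ℝ) ^ 2 : ℝ) : ℂ) by push_cast; rfl,
      Complex.div_ofReal_re, Complex.exp_ofReal_mul_I_re]
    ring
  simp only [e] at h2
  rw [h2.unique h3]
  have b2 : Polynomial.eval x (Polynomial.map (algebraMap ℚ ℝ) (Polynomial.bernoulli 2)) =
      x ^ 2 - x + 1 / 6 := by
    simp only [Polynomial.bernoulli, Finset.sum_range_succ, Finset.range_zero, Finset.sum_empty,
      Polynomial.map_add, Polynomial.map_monomial, Polynomial.eval_add, Polynomial.eval_monomial]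
    simp [bernoulli_one, bernoulli_two]
    ring
  rw [mul_one, b2, Nat.factorial_two]
  push_cast
  ring

theorem re_dilog_theta : (dilog theta).re = 11 * Real.pi ^ 2 / 192 := by
  have h := re_dilog_exp (x := 1 / 8) ⟨by norm_num, by norm_num⟩
  rw [show ((2 * Real.pi * (1 / 8) : ℝ) : ℂ) * Complex.I = Real.pi * Complex.I / 4 by
    push_cast; ring] at h
  rw [theta, h]; ring

theorem re_dilog_neg_theta : (dilog (-theta)).re = -13 * Real.pi ^ 2 / 192 := by
  have h := re_dilog_exp (x := 5 / 8) ⟨by norm_num, by norm_num⟩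
  rw [show ((2 * Real.pi * (5 / 8) : ℝ) : ℂ) * Complex.I =
    Real.pi * Complex.I / 4 + Real.pi * Complex.I by push_cast; ring, Complex.exp_add,
    Complex.exp_pi_mul_I, mul_neg_one] at h
  rw [theta, h]; ring

/-- Even powers cancel. For odd n the difference is 2θⁿ, with imaginary part √2 for n ≡ 1, 3 and -√2
for n ≡ 5, 7 mod 8. -/
theorem im_theta_pow_sub (n : ℕ) :
    (theta ^ n - (-theta) ^ n).im = √2 * (ZMod.χ₈' (n : ZMod 8) : ℝ) := by
  have h8 : theta ^ 8 = 1 := by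
    rw [show theta ^ 8 = (theta ^ 2) ^ 4 by ring, theta_sq, Complex.I_pow_four]
  obtain ⟨m, j, hj, rfl⟩ : ∃ m j, j < 8 ∧ n = 8 * m + j :=
    ⟨n / 8, n % 8, Nat.mod_lt _ (by norm_num), (Nat.div_add_mod n 8).symm⟩
  have e1 : ((8 * m + j : ℕ) : ZMod 8) = (j : ZMod 8) := by
    push_cast
    rw [show (8 : ZMod 8) = 0 from rfl, zero_mul, zero_add]
  rw [e1, pow_add, pow_add, pow_mul, pow_mul, Even.neg_pow (by decide : Even 8), h8, one_pow,
    one_mul, one_mul]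
  have e3 : theta ^ 3 = Complex.I * theta := by rw [pow_succ, theta_sq]
  have e5 : theta ^ 5 = -theta := by
    rw [show theta ^ 5 = theta ^ 2 * theta ^ 2 * theta by ring, theta_sq, Complex.I_mul_I]; ring
  have e7 : theta ^ 7 = -(Complex.I * theta) := by
    rw [show theta ^ 7 = theta ^ 2 * theta ^ 2 * theta ^ 3 by ring, theta_sq, Complex.I_mul_I, e3]
    ring
  interval_cases j
  · simp
  · rw [pow_one, pow_one, show ZMod.χ₈' ((1 : ℕ) : ZMod 8) = 1 from by decide]
    simp [theta_im]
  · rw [Even.neg_pow (by decide), show ZMod.χ₈' ((2 : ℕ) : ZMod 8) = 0 from by decide]; simp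
  · rw [Odd.neg_pow (by decide), e3, show ZMod.χ₈' ((3 : ℕ) : ZMod 8) = 1 from by decide]
    simp [theta_re]
  · rw [Even.neg_pow (by decide), show ZMod.χ₈' ((4 : ℕ) : ZMod 8) = 0 from by decide]; simp
  · rw [Odd.neg_pow (by decide), e5, show ZMod.χ₈' ((5 : ℕ) : ZMod 8) = -1 from by decide]
    simp [theta_im]; ring
  · rw [Even.neg_pow (by decide), show ZMod.χ₈' ((6 : ℕ) : ZMod 8) = 0 from by decide]; simp
  · rw [Odd.neg_pow (by decide), e7, show ZMod.χ₈' ((7 : ℕ) : ZMod 8) = -1 from by decide]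
    simp [theta_re]; ring

theorem im_dilog_theta_sub : (dilog theta - dilog (-theta)).im = √2 * LConst := by
  have h1 := (hasSum_dilog norm_theta.le).sub
    (hasSum_dilog (z := -theta) (by rw [norm_neg, norm_theta]))
  have h2 := Complex.hasSum_im h1
  rw [LConst, ← tsum_mul_left, ← h2.tsum_eq]
  congr 1; ext n
  rw [← sub_div, show ((n : ℂ) ^ 2) = (((n : ℝ) ^ 2 : ℝ) : ℂ) by push_cast; rfl,
    Complex.div_ofReal_im, im_theta_pow_sub]
  ring

/-- Since θ² = i, duplication gives Im(Li₂(θ) + Li₂(-θ)) = G/2, while the difference has imaginary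
part √2 L; average the two. -/
theorem imLi2_sub_catalanG : imLi2 - catalanG / 4 = LConst / √2 := by
  have h1 := congrArg Complex.im (dilog_add_dilog_neg norm_theta.le)
  have h2 := im_dilog_theta_sub
  rw [theta_sq, show (dilog Complex.I / 2) = dilog Complex.I / ((2 : ℝ) : ℂ) by simp,
    Complex.div_ofReal_im, Complex.add_im] at h1
  rw [Complex.sub_im] at h2
  have h3 : LConst / √2 = √2 * LConst / 2 := by
    rw [div_eq_div_iff sqrt_two_ne_zero two_ne_zero]
    linear_combination (-LConst) * Real.mul_self_sqrt (show (0 : ℝ) ≤ 2 by norm_num)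
  rw [imLi2_eq, catalanG_eq, h3]
  linarith

/-! ### Functional equations of the real dilogarithm. -/

theorem eq_of_hasDerivAt_zero {f : ℝ → ℝ} {a b : ℝ} (hab : a ≤ b)
    (hc : ContinuousOn f (Set.Icc a b)) (hd : ∀ x ∈ Set.Ioo a b, HasDerivAt f 0 x) :
    f a = f b := by
  rcases hab.eq_or_lt with rfl | h
  · rfl
  · obtain ⟨c, -, hc⟩ := exists_hasDerivAt_eq_slope f (fun _ => 0) h hc hd
    have : b - a ≠ 0 := by linarith
    rw [eq_comm, div_eq_zero_iff] at hc
    rcases hc with hc | hc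
    · linarith
    · exact absurd hc this

/-- The real dilogarithm on `(-∞, 1]`. -/
noncomputable def reDilog (x : ℝ) : ℝ := (dilog x).re

theorem one_sub_ofReal_mem_slitPlane {x : ℝ} (hx : x < 1) :
    1 - (x : ℂ) ∈ Complex.slitPlane := by
  rw [Complex.mem_slitPlane_iff]; left; simpa using hx

theorem hasDerivAt_reDilog {x : ℝ} (hx : x < 1) (h0 : x ≠ 0) :
    HasDerivAt reDilog (-(Real.log (1 - x) / x)) x := by
  have h := (hasDerivAt_dilog (one_sub_ofReal_mem_slitPlane hx)
    (by exact_mod_cast h0)).real_of_complex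
  refine h.congr_deriv ?_
  rw [show (1 - (x : ℂ)) = ((1 - x : ℝ) : ℂ) by push_cast; rfl, ← Complex.ofReal_log (by linarith),
    ← Complex.ofReal_div, ← Complex.ofReal_neg, Complex.ofReal_re]

theorem continuousAt_reDilog {x : ℝ} (hx : x < 1) : ContinuousAt reDilog x :=
  Complex.continuous_re.continuousAt.comp
    ((continuousAt_dilog (one_sub_ofReal_mem_slitPlane hx)).comp
      Complex.continuous_ofReal.continuousAt)

theorem hasSum_reDilog {x : ℝ} (hx : |x| ≤ 1) :
    HasSum (fun n : ℕ => x ^ n / (n : ℝ) ^ 2) (reDilog x) := by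
  refine (Complex.hasSum_re (hasSum_dilog (z := x) (by simpa using hx))).congr_fun fun n => ?_
  rw [← Complex.ofReal_pow, ← Complex.ofReal_natCast, ← Complex.ofReal_pow, ← Complex.ofReal_div,
    Complex.ofReal_re]

/-- At x = 1 the argument 1 - x leaves the slit plane; uniform convergence of the series takes over.
-/
theorem continuousOn_reDilog : ContinuousOn reDilog (Set.Icc 0 1) := by
  have h : ContinuousOn (fun x : ℝ => ∑' n : ℕ, x ^ n / (n : ℝ) ^ 2) (Set.Icc 0 1) := by
    refine continuousOn_tsum (fun n => by fun_prop) (Real.summable_one_div_nat_pow.mpr one_lt_two)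
      fun n x hx => ?_
    rw [norm_div, norm_pow, Real.norm_of_nonneg hx.1, Real.norm_of_nonneg (by positivity)]
    gcongr
    exact pow_le_one₀ hx.1 hx.2
  refine h.congr fun x hx => ?_
  exact (hasSum_reDilog (abs_le.mpr ⟨by linarith [hx.1], hx.2⟩)).tsum_eq.symm

theorem reDilog_zero : reDilog 0 = 0 := by simp [reDilog, dilog]

theorem reDilog_one : reDilog 1 = Real.pi ^ 2 / 6 := by
  have h := hasSum_reDilog (x := 1) (by simp)
  simp only [one_pow] at h
  exact h.unique hasSum_zeta_two

theorem reDilog_add_reDilog_neg {x : ℝ} (hx : |x| ≤ 1) :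
    reDilog x + reDilog (-x) = reDilog (x ^ 2) / 2 := by
  have h := congrArg Complex.re (dilog_add_dilog_neg (z := x) (by simpa using hx))
  rw [show ∀ w : ℂ, w / 2 = w / ((2 : ℝ) : ℂ) from fun w => by simp, Complex.div_ofReal_re,
    Complex.add_re] at h
  simpa [reDilog] using h

theorem reDilog_neg_one : reDilog (-1) = -(Real.pi ^ 2 / 12) := by
  have h := reDilog_add_reDilog_neg (x := 1) (by simp)
  rw [one_pow, reDilog_one] at h
  linarith

/-- The product is x log x times the difference quotient of log(1+ax) at 0; the convention log 0 = 0
gives the limit value 0. -/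
theorem continuousAt_log_mul_log (a : ℝ) :
    ContinuousAt (fun x : ℝ => Real.log x * Real.log (1 + a * x)) 0 := by
  have hd : DifferentiableAt ℝ (fun x : ℝ => Real.log (1 + a * x)) 0 :=
    DifferentiableAt.log (by fun_prop) (by simp)
  have e : (fun x : ℝ => Real.log x * Real.log (1 + a * x)) =
      fun x => x * Real.log x * dslope (fun x : ℝ => Real.log (1 + a * x)) 0 x := by
    ext x
    rcases eq_or_ne x 0 with rfl | hx
    · simp
    · rw [dslope_of_ne _ hx, slope_def_field]
      simp
      field_simp
  rw [e]
  exact Real.continuous_mul_log.continuousAt.mul (continuousAt_dslope_same.mpr hd)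

/-- Landen's identity. -/
theorem reDilog_landen {x : ℝ} (hx : 0 ≤ x) :
    reDilog (-x) + reDilog (x / (1 + x)) + Real.log (1 + x) ^ 2 / 2 = 0 := by
  have h := eq_of_hasDerivAt_zero
    (f := fun x => reDilog (-x) + reDilog (x / (1 + x)) + Real.log (1 + x) ^ 2 / 2) hx ?_ ?_
  · rw [← h]; simp [reDilog_zero]
  · intro y hy
    have h1 : 0 < 1 + y := by linarith [hy.1]
    have h2 : y / (1 + y) < 1 := by rw [div_lt_one h1]; linarith
    have hy' : -y < 1 := by linarith [hy.1]
    have c1 : ContinuousAt (fun z : ℝ => reDilog (-z)) y :=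
      ContinuousAt.comp (f := fun z : ℝ => -z) (continuousAt_reDilog hy') continuousAt_neg
    have c2 : ContinuousAt (fun z : ℝ => z / (1 + z)) y :=
      ContinuousAt.div continuousAt_id (by fun_prop) h1.ne'
    have c3 : ContinuousAt (fun z : ℝ => reDilog (z / (1 + z))) y :=
      ContinuousAt.comp (f := fun z : ℝ => z / (1 + z)) (continuousAt_reDilog h2) c2
    have c4 : ContinuousAt (fun z : ℝ => Real.log (1 + z)) y :=
      ContinuousAt.log (by fun_prop) h1.ne'
    exact ((c1.add c3).add ((c4.pow 2).div_const 2)).continuousWithinAt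
  · intro y hy
    have h1 : 0 < 1 + y := by linarith [hy.1]
    have h2 : y / (1 + y) < 1 := by rw [div_lt_one h1]; linarith
    have hy0 : y ≠ 0 := hy.1.ne'
    have d1 := (hasDerivAt_reDilog (x := -y) (by linarith [hy.1]) (neg_ne_zero.mpr hy0)).comp y
      (hasDerivAt_neg y)
    have da : HasDerivAt (fun z : ℝ => 1 + z) 1 y := (hasDerivAt_id y).const_add 1
    have d2 := (hasDerivAt_reDilog h2 (by positivity)).comp y ((hasDerivAt_id y).div da h1.ne')
    have d3 := ((da.log h1.ne').pow 2).div_const 2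
    refine ((d1.add d2).add d3).congr_deriv ?_
    have e : 1 - y / (1 + y) = (1 + y)⁻¹ := by field_simp; ring
    simp only [id, e, Real.log_inv, sub_neg_eq_add]
    field_simp
    ring

/-- Euler's reflection formula. -/
theorem reDilog_reflection {x : ℝ} (hx : 0 < x) (hx1 : x < 1) :
    reDilog x + reDilog (1 - x) + Real.log x * Real.log (1 - x) = Real.pi ^ 2 / 6 := by
  have h := eq_of_hasDerivAt_zero
    (f := fun x => reDilog x + reDilog (1 - x) + Real.log x * Real.log (1 - x)) hx.le ?_ ?_
  · rw [← h]; simp [reDilog_zero, reDilog_one]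
  · refine ContinuousOn.add (ContinuousOn.add ?_ ?_) ?_
    · exact fun y hy => (continuousAt_reDilog (by linarith [hy.2])).continuousWithinAt
    · exact continuousOn_reDilog.comp (by fun_prop)
        fun y hy => ⟨by linarith [hy.2], by linarith [hy.1]⟩
    · intro y hy
      apply ContinuousAt.continuousWithinAt
      rcases hy.1.eq_or_lt with h0 | h0
      · rw [← h0]
        simpa [sub_eq_add_neg] using continuousAt_log_mul_log (-1)
      · exact (Real.continuousAt_log h0.ne').mul
          (ContinuousAt.log (by fun_prop) (by linarith [hy.2]))
  · intro y hy
    have hy0 : y ≠ 0 := hy.1.ne'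
    have hy1 : 1 - y ≠ 0 := by linarith [hy.2]
    have ds : HasDerivAt (fun z : ℝ => 1 - z) (-1) y := (hasDerivAt_id y).const_sub 1
    have d1 := hasDerivAt_reDilog (x := y) (by linarith [hy.2]) hy0
    have d2 := (hasDerivAt_reDilog (x := 1 - y) (by linarith [hy.1]) hy1).comp y ds
    have d3 := (Real.hasDerivAt_log hy0).mul (ds.log hy1)
    refine ((d1.add d2).add d3).congr_deriv ?_
    rw [sub_sub_cancel]
    field_simp
    ring

/-- The functional equation of Legendre's chi function under `x ↦ (1 - x) / (1 + x)`. -/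
theorem reDilog_legendre {x : ℝ} (hx : 0 < x) (hx1 : x < 1) :
    reDilog x - reDilog (-x) + (reDilog ((1 - x) / (1 + x)) - reDilog (-((1 - x) / (1 + x)))) -
      (Real.log x * Real.log (1 + x) - Real.log x * Real.log (1 - x)) = Real.pi ^ 2 / 4 := by
  have h := eq_of_hasDerivAt_zero
    (f := fun x => reDilog x - reDilog (-x) +
      (reDilog ((1 - x) / (1 + x)) - reDilog (-((1 - x) / (1 + x)))) -
      (Real.log x * Real.log (1 + x) - Real.log x * Real.log (1 - x))) hx.le ?_ ?_
  · rw [← h]; simp [reDilog_zero, reDilog_one, reDilog_neg_one]; ring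
  · have hm : ContinuousOn (fun y : ℝ => (1 - y) / (1 + y)) (Set.Icc 0 x) :=
      ContinuousOn.div (by fun_prop) (by fun_prop) fun y hy => by linarith [hy.1]
    refine ContinuousOn.sub (ContinuousOn.add (ContinuousOn.sub ?_ ?_)
      (ContinuousOn.sub ?_ ?_)) (ContinuousOn.sub ?_ ?_)
    · exact fun y hy => (continuousAt_reDilog (by linarith [hy.2])).continuousWithinAt
    · exact fun y hy => (ContinuousAt.comp (g := reDilog) (continuousAt_reDilog (by linarith [hy.1]))
        (by fun_prop)).continuousWithinAt
    · refine continuousOn_reDilog.comp hm fun y hy => ?_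
      have h1 : 0 < 1 + y := by linarith [hy.1]
      exact ⟨div_nonneg (by linarith [hy.2]) h1.le, by rw [div_le_one h1]; linarith [hy.1]⟩
    · intro y hy
      have h1 : 0 < 1 + y := by linarith [hy.1]
      have h2 : 0 ≤ (1 - y) / (1 + y) := div_nonneg (by linarith [hy.2]) h1.le
      exact ContinuousAt.comp_continuousWithinAt (g := reDilog) (continuousAt_reDilog (by linarith))
        (hm y hy).neg
    · intro y hy
      apply ContinuousAt.continuousWithinAt
      rcases hy.1.eq_or_lt with h0 | h0
      · rw [← h0]
        simpa using continuousAt_log_mul_log 1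
      · exact (Real.continuousAt_log h0.ne').mul
          (ContinuousAt.log (by fun_prop) (by linarith [hy.2]))
    · intro y hy
      apply ContinuousAt.continuousWithinAt
      rcases hy.1.eq_or_lt with h0 | h0
      · rw [← h0]
        simpa [sub_eq_add_neg] using continuousAt_log_mul_log (-1)
      · exact (Real.continuousAt_log h0.ne').mul
          (ContinuousAt.log (by fun_prop) (by linarith [hy.2]))
  · intro y hy
    have hy0 : 0 < y := hy.1
    have hy1 : 0 < 1 - y := by linarith [hy.2]
    have hy2 : 0 < 1 + y := by linarith
    have hm0 : 0 < (1 - y) / (1 + y) := by positivity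
    have hm1 : (1 - y) / (1 + y) < 1 := by rw [div_lt_one hy2]; linarith
    have ds : HasDerivAt (fun z : ℝ => 1 - z) (-1) y := (hasDerivAt_id y).const_sub 1
    have da : HasDerivAt (fun z : ℝ => 1 + z) 1 y := (hasDerivAt_id y).const_add 1
    have dm := ds.div da hy2.ne'
    have d1 := hasDerivAt_reDilog (x := y) (by linarith) hy0.ne'
    have d2 := (hasDerivAt_reDilog (x := -y) (by linarith) (by linarith)).comp y (hasDerivAt_neg y)
    have d3 := (hasDerivAt_reDilog hm1 hm0.ne').comp y dm
    have d4 := (hasDerivAt_reDilog (x := -((1 - y) / (1 + y))) (by linarith) (by linarith)).comp y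
      dm.neg
    have d5 := (Real.hasDerivAt_log hy0.ne').mul (da.log hy2.ne')
    have d6 := (Real.hasDerivAt_log hy0.ne').mul (ds.log hy1.ne')
    refine (((d1.sub d2).add (d3.sub d4)).sub (d5.sub d6)).congr_deriv ?_
    have e1 : 1 - (1 - y) / (1 + y) = 2 * y / (1 + y) := by field_simp; ring
    have e2 : 1 - -((1 - y) / (1 + y)) = 2 / (1 + y) := by field_simp; ring
    rw [e1, e2, Real.log_div (by positivity) hy2.ne', Real.log_div two_ne_zero hy2.ne',
      Real.log_mul two_ne_zero hy0.ne', sub_neg_eq_add]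
    field_simp
    ring

/-! ### The kernel 1/(2-y²) and reduction to Li₂(ρ). -/

/-- `ρ = √2 - 1`. -/
noncomputable def rho : ℝ := √2 - 1

theorem sqrt_two_eq : √(2 : ℝ) = rho + 1 := by rw [rho]; ring

theorem rho_sq : rho ^ 2 = 1 - 2 * rho := by
  have h : √(2 : ℝ) ^ 2 = 2 := Real.sq_sqrt (by norm_num)
  rw [sqrt_two_eq] at h
  linarith

theorem rho_pos : 0 < rho := by
  rw [rho, sub_pos]; exact Real.one_lt_sqrt_two

theorem rho_lt_half : rho < 1 / 2 := by nlinarith [rho_sq, rho_pos]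

theorem rho_inv : rho⁻¹ = rho + 2 := by
  rw [inv_eq_iff_eq_inv, eq_comm, inv_eq_iff_eq_inv, eq_comm]
  have := rho_pos.ne'
  field_simp
  linarith [rho_sq]

theorem log_rho : Real.log rho = -Real.log (1 + √2) := by
  rw [show 1 + √2 = rho⁻¹ by rw [rho_inv, sqrt_two_eq]; ring, Real.log_inv, neg_neg]

theorem log_sqrt_two : Real.log √2 = Real.log 2 / 2 := Real.log_sqrt (by norm_num)

theorem reDilog_half : reDilog (1 / 2) = Real.pi ^ 2 / 12 - Real.log 2 ^ 2 / 2 := by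
  have h := reDilog_reflection (x := 1 / 2) (by norm_num) (by norm_num)
  rw [show (1 : ℝ) - 1 / 2 = 1 / 2 by norm_num, show (1 / 2 : ℝ) = 2⁻¹ by norm_num,
    Real.log_inv] at h
  rw [show (1 / 2 : ℝ) = 2⁻¹ by norm_num]
  linarith

/-- ρ is the fixed point of x ↦ (1-x)/(1+x), so Legendre's equation there evaluates Li₂(ρ) -
Li₂(-ρ); duplication brings in ρ². -/
theorem reDilog_rho_sq :
    reDilog (rho ^ 2) = 4 * reDilog rho + Real.log (1 + √2) ^ 2 - Real.pi ^ 2 / 4 := by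
  have hr := rho_pos
  have hr1 := rho_lt_half
  have h := reDilog_legendre hr (by linarith)
  have e : (1 - rho) / (1 + rho) = rho := by
    rw [div_eq_iff (by linarith)]; linarith [rho_sq]
  have d := reDilog_add_reDilog_neg (x := rho) (by rw [abs_of_pos hr]; linarith)
  have l : Real.log (1 - rho) = Real.log rho + Real.log (1 + rho) := by
    rw [← Real.log_mul hr.ne' (by linarith)]; congr 1; linarith [rho_sq]
  rw [e, l, log_rho] at h
  linarith

theorem integral_log_mul_real {x : ℝ} (hx : |x| ≤ 1) :
    ∫ t in (0 : ℝ)..1, Real.log t * (x / (1 - t * x)) = -reDilog x := by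
  have h := integral_log_mul_div_one_sub (z := x) (by simpa using hx)
  rw [show (fun t : ℝ => (Real.log t : ℂ) * ((x : ℂ) / (1 - t * x))) =
    fun t : ℝ => ((Real.log t * (x / (1 - t * x)) : ℝ) : ℂ) by ext t; push_cast; rfl,
    integral_ofReal] at h
  rw [reDilog, ← Complex.neg_re, ← h, Complex.ofReal_re]

/-- Splitting 1/(2-t²) at t = ±√2 gives Li₂(±√2/2). Duplication relates these to Li₂(1/2), and
Landen's identity at x = √2/2 has x/(1+x) = ρ. -/
theorem intTwoSub_log : intTwoSub Real.log = -(reDilog rho + reDilog (1 / 2) / 4 +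
    (Real.log (1 + √2) - Real.log 2 / 2) ^ 2 / 2) / √2 := by
  have hs : √(2 : ℝ) ^ 2 = 2 := Real.sq_sqrt (by norm_num)
  have hs0 : 0 < √(2 : ℝ) := by positivity
  have hs1 : √(2 : ℝ) < 2 := by nlinarith
  have habs : |√(2 : ℝ) / 2| ≤ 1 := by rw [abs_of_pos (by positivity)]; linarith
  have i : ∀ x : ℝ, |x| < 1 → IntervalIntegrable (fun t => Real.log t * (x / (1 - t * x)))
      volume 0 1 := fun x hx => by
    refine intervalIntegrable_log'.mul_continuousOn ?_
    refine ContinuousOn.div (by fun_prop) (by fun_prop) fun t ht => ?_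
    rw [Set.uIcc_of_le zero_le_one] at ht
    nlinarith [ht.1, ht.2, le_abs_self x, abs_nonneg x]
  have habs' : |√(2 : ℝ) / 2| < 1 := by rw [abs_of_pos (by positivity)]; linarith
  have h1 := integral_log_mul_real habs
  have h2 := integral_log_mul_real (x := -(√2 / 2)) (by rwa [abs_neg])
  have e : intTwoSub Real.log = (-reDilog (√2 / 2) - -reDilog (-(√2 / 2))) / (2 * √2) := by
    rw [intTwoSub, ← h1, ← h2, ← integral_sub (i _ habs') (i _ (by rwa [abs_neg])),
      ← intervalIntegral.integral_div]
    refine integral_congr fun t ht => ?_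
    rw [Set.uIcc_of_le zero_le_one] at ht
    have n1 : 2 - t ^ 2 ≠ 0 := (two_sub_sq_pos ht).ne'
    have n2 : 1 - t * (√2 / 2) ≠ 0 := by nlinarith [ht.1, ht.2]
    have n3 : 1 - t * -(√2 / 2) ≠ 0 := by nlinarith [ht.1, ht.2]
    have n4 : (1 - t * (√2 / 2)) * (1 - t * -(√2 / 2)) = (2 - t ^ 2) / 2 := by
      linear_combination (-t ^ 2 / 4) * hs
    have n5 : √2 / 2 / (1 - t * (√2 / 2)) - -(√2 / 2) / (1 - t * -(√2 / 2)) =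
        2 * √2 / (2 - t ^ 2) := by
      rw [div_sub_div _ _ n2 n3, n4, div_eq_div_iff (by positivity) n1]
      ring
    rw [← mul_sub, n5]
    field_simp
  have l := reDilog_landen (x := √2 / 2) (by positivity)
  have d := reDilog_add_reDilog_neg habs
  rw [show √(2 : ℝ) / 2 / (1 + √2 / 2) = rho by
    rw [rho, div_eq_iff (by positivity)]; linear_combination (-1 / 2) * hs,
    show 1 + √(2 : ℝ) / 2 = (1 + √2) / √2 by rw [eq_div_iff hs0.ne']; linear_combination (1 / 2) * hs,
    Real.log_div (by positivity) hs0.ne', log_sqrt_two] at l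
  rw [show (√(2 : ℝ) / 2) ^ 2 = 1 / 2 by rw [div_pow, hs]; norm_num] at d
  rw [e, div_eq_div_iff (by positivity) hs0.ne',
    show reDilog (√2 / 2) = reDilog (1 / 2) / 2 - reDilog (-(√2 / 2)) by linarith,
    show reDilog (-(√2 / 2)) = -reDilog rho - (Real.log (1 + √2) - Real.log 2 / 2) ^ 2 / 2 by
      linarith]
  ring

/-- This is the integral of log(1-y²) after u = 1-y and u = 1+y. Since 1/ρ = ρ+2, the denominator is
(u+ρ)(1/ρ-u), and each simple pole gives a logarithm product plus a dilogarithm. -/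
theorem integral_log_mul_div_two_sub :
    ∫ u in (0 : ℝ)..2, Real.log u * (2 * √2 / (2 - (1 - u) ^ 2)) =
      4 * Real.log 2 * Real.log (1 + √2) + reDilog (-(2 / rho)) - reDilog (2 * rho) := by
  have hr := rho_pos
  have hr1 := rho_lt_half
  have hri := rho_inv
  have hden : ∀ u : ℝ, 2 - (1 - u) ^ 2 = (u + rho) * (rho + 2 - u) := fun u => by
    linear_combination -rho_sq
  have pos1 : ∀ u ∈ Set.Icc (0 : ℝ) 2, 0 < 1 + u / rho := fun u hu => by
    have := hu.1; positivity
  have pos2 : ∀ u ∈ Set.Icc (0 : ℝ) 2, 0 < 1 - rho * u := fun u hu => by nlinarith [hu.1, hu.2]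
  have key := integral_eq_of_antideriv (a := 0) (b := 2) (f := fun u =>
    Real.log u * (2 * √2 / (2 - (1 - u) ^ 2))) (fun u => Real.log u * Real.log (1 + rho⁻¹ * u) +
    reDilog (-(u / rho)) - Real.log u * Real.log (1 + (-rho) * u) - reDilog (rho * u))
    zero_le_two ?_ ?_ ?_
  · rw [key]
    simp only [mul_zero, neg_zero, zero_div, reDilog_zero, Real.log_zero, zero_mul, sub_zero,
      add_zero]
    have e1 : 1 + rho⁻¹ * 2 = (rho ^ 2)⁻¹ := by
      rw [rho_inv, ← inv_pow, rho_inv]; linear_combination -rho_sq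
    have e2 : 1 + -rho * 2 = rho ^ 2 := by rw [rho_sq]; ring
    rw [e1, e2, Real.log_inv, Real.log_pow, log_rho, mul_comm rho 2]
    push_cast
    ring
  · have c : ∀ a : ℝ, (∀ u ∈ Set.Icc (0 : ℝ) 2, 0 < 1 + a * u) →
        ContinuousOn (fun u => Real.log u * Real.log (1 + a * u)) (Set.Icc 0 2) := fun a ha u hu => by
      apply ContinuousAt.continuousWithinAt
      rcases hu.1.eq_or_lt with h0 | h0
      · rw [← h0]; exact continuousAt_log_mul_log a
      · exact (Real.continuousAt_log h0.ne').mul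
          (ContinuousAt.log (by fun_prop) (ha u hu).ne')
    refine ContinuousOn.sub (ContinuousOn.sub (ContinuousOn.add (c _ fun u hu => ?_) ?_)
      (c _ fun u hu => ?_)) ?_
    · have := pos1 u hu; rwa [div_eq_inv_mul] at this
    · intro u hu
      have h := pos1 u hu
      exact (ContinuousAt.comp (f := fun u : ℝ => -(u / rho)) (continuousAt_reDilog (by linarith))
        (by fun_prop)).continuousWithinAt
    · have := pos2 u hu; linarith
    · intro u hu
      have h := pos2 u hu
      exact (ContinuousAt.comp (f := fun u : ℝ => rho * u) (continuousAt_reDilog (by linarith))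
        (by fun_prop)).continuousWithinAt
  · intro u hu
    have hu' : u ∈ Set.Icc (0 : ℝ) 2 := ⟨hu.1.le, hu.2.le⟩
    have p1 := pos1 u hu'
    have p2 := pos2 u hu'
    have hu0 : 0 < u := hu.1
    have q1 : 1 + rho⁻¹ * u ≠ 0 := by rw [← div_eq_inv_mul]; exact p1.ne'
    have q2 : 1 + -rho * u ≠ 0 := by linarith
    have da : ∀ a : ℝ, HasDerivAt (fun z : ℝ => 1 + a * z) a u := fun a => by
      simpa using ((hasDerivAt_id u).const_mul a).const_add 1
    have d1 := (Real.hasDerivAt_log hu0.ne').mul ((da rho⁻¹).log q1)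
    have d2 := (hasDerivAt_reDilog (x := -(u / rho)) (by linarith)
      (neg_ne_zero.mpr (by positivity))).comp u ((hasDerivAt_id u).div_const rho).neg
    have d3 := (Real.hasDerivAt_log hu0.ne').mul ((da (-rho)).log q2)
    have d4 := (hasDerivAt_reDilog (x := rho * u) (by linarith) (by positivity)).comp u
      ((hasDerivAt_id u).const_mul rho)
    refine (((d1.add d2).sub d3).sub d4).congr_deriv ?_
    have e1 : 1 - -(u / rho) = 1 + rho⁻¹ * u := by rw [div_eq_inv_mul]; ring
    have e2 : 1 + -rho * u = 1 - rho * u := by ring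
    have e3 : 1 + rho⁻¹ * u = (u + rho) / rho := by field_simp; ring
    have e4 : rho + 2 - u = (1 - rho * u) / rho := by
      rw [eq_div_iff hr.ne']; linear_combination rho_sq
    have n3 : u + rho ≠ 0 := by positivity
    have n4 := p2.ne'
    rw [e1, e2, hden, e4, sqrt_two_eq]
    rw [e3]
    have n5 : 1 - u * rho ≠ 0 := by rw [mul_comm]; exact n4
    field_simp
    linear_combination (-u * Real.log u) * rho_sq
  · refine intervalIntegrable_log'.mul_continuousOn ?_
    refine ContinuousOn.div (by fun_prop) (by fun_prop) fun u hu => ?_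
    rw [Set.uIcc_of_le zero_le_two] at hu
    rw [hden]
    have h1 : 0 < u + rho := by linarith [hu.1]
    have h2 : 0 < rho + 2 - u := by linarith [hu.2]
    positivity

/-- Landen's identity at 2/ρ turns the first dilogarithm into Li₂(2ρ). As 2ρ = 1-ρ², reflection
leads to Li₂(ρ²), hence to Li₂(ρ). -/
theorem intTwoSub_log_one_sub_sq : intTwoSub (fun y => Real.log (1 - y ^ 2)) =
    (4 * Real.log (1 + √2) ^ 2 - 5 * Real.pi ^ 2 / 6 + 8 * reDilog rho) / (2 * √2) := by
  have hr := rho_pos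
  have hr1 := rho_lt_half
  have hs0 : 0 < √(2 : ℝ) := by positivity
  have ii : ∀ a b : ℝ, a ≤ b → 0 ≤ a → b ≤ 2 →
      IntervalIntegrable (fun u => Real.log u * (2 * √2 / (2 - (1 - u) ^ 2))) volume a b :=
      fun a b hab ha hb => by
    refine intervalIntegrable_log'.mul_continuousOn ?_
    refine ContinuousOn.div (by fun_prop) (by fun_prop) fun u hu => ?_
    rw [Set.uIcc_of_le hab] at hu
    nlinarith [hu.1, hu.2]
  have h1 : IntervalIntegrable (fun y : ℝ => Real.log (1 - y) * (2 * √2 / (2 - y ^ 2))) volume 0 1 := by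
    have := (ii 0 1 zero_le_one le_rfl one_le_two).symm.comp_sub_left 1
    simpa using this
  have h2 : IntervalIntegrable (fun y : ℝ => Real.log (1 + y) * (2 * √2 / (2 - y ^ 2))) volume 0 1 := by
    have := (ii 1 2 one_le_two zero_le_one le_rfl).comp_add_left 1
    norm_num at this
    simpa using this
  have e : 2 * √2 * intTwoSub (fun y => Real.log (1 - y ^ 2)) =
      ∫ u in (0 : ℝ)..2, Real.log u * (2 * √2 / (2 - (1 - u) ^ 2)) := by
    rw [← integral_add_adjacent_intervals (ii 0 1 zero_le_one le_rfl one_le_two)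
      (ii 1 2 one_le_two zero_le_one le_rfl)]
    have c1 := integral_comp_sub_left (a := 0) (b := 1)
      (fun u => Real.log u * (2 * √2 / (2 - (1 - u) ^ 2))) 1
    have c2 := integral_comp_add_left (a := 0) (b := 1)
      (fun u => Real.log u * (2 * √2 / (2 - (1 - u) ^ 2))) 1
    norm_num at c1 c2
    rw [← c1, ← c2, ← integral_add h1 h2, intTwoSub, ← intervalIntegral.integral_const_mul]
    refine integral_congr_Ioo_of_le zero_le_one fun y hy => ?_
    have p1 : 0 < 1 - y := by linarith [hy.2]
    have p2 : 0 < 1 + y := by linarith [hy.1]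
    rw [show 1 - y ^ 2 = (1 - y) * (1 + y) by ring, Real.log_mul p1.ne' p2.ne']
    ring
  have l := reDilog_landen (x := 2 / rho) (by positivity)
  have e1 : 1 + 2 / rho = (rho ^ 2)⁻¹ := by
    rw [div_eq_mul_inv, ← inv_pow, rho_inv]; linear_combination -rho_sq
  have e2 : 2 / rho / (1 + 2 / rho) = 2 * rho := by rw [e1]; field_simp
  rw [e2, e1, Real.log_inv, Real.log_pow, log_rho] at l
  have rf := reDilog_reflection (x := rho ^ 2) (by positivity) (by nlinarith)
  rw [show 1 - rho ^ 2 = 2 * rho by rw [rho_sq]; ring, Real.log_pow,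
    Real.log_mul two_ne_zero hr.ne', log_rho, reDilog_rho_sq] at rf
  rw [integral_log_mul_div_two_sub] at e
  rw [eq_div_iff (by positivity), mul_comm, e]
  push_cast at l rf
  linear_combination l - 2 * rf

/-! ### The kernels 1/(1+y⁴) and y²/(1+y⁴). -/

theorem quartic_integrals_log :
    intQuartic Real.log - intSqQuartic Real.log = -(√2 * Real.pi ^ 2 / 16) ∧
    intQuartic Real.log + intSqQuartic Real.log = -LConst := by
  have hs : √(2 : ℝ) ^ 2 = 2 := Real.sq_sqrt (by norm_num)
  have hn : ∀ z : ℂ, z ^ 2 = Complex.I → ∀ t : ℝ, 1 - (t : ℂ) * z ≠ 0 := fun z hz t h => by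
    have h1 : (t : ℂ) * z = 1 := by linear_combination -h
    have h2 : ((t : ℂ) * z) ^ 2 = 1 := by rw [h1, one_pow]
    rw [mul_pow, hz] at h2
    have := congrArg Complex.re h2
    rw [← Complex.ofReal_pow, Complex.re_ofReal_mul] at this
    simp at this
  have i : ∀ z : ℂ, z ^ 2 = Complex.I → IntervalIntegrable
      (fun t : ℝ => (Real.log t : ℂ) * (z / (1 - t * z))) volume 0 1 := fun z hz => by
    have hl : IntervalIntegrable (fun t : ℝ => (Real.log t : ℂ)) volume 0 1 :=
      ⟨intervalIntegrable_log'.1.ofReal, intervalIntegrable_log'.2.ofReal⟩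
    exact hl.mul_continuousOn (ContinuousOn.div (by fun_prop) (by fun_prop)
      fun t _ => hn z hz t)
  have hneg : (-theta) ^ 2 = Complex.I := by rw [neg_sq, theta_sq]
  have i1 := intervalIntegrable_div_one_add_pow_four intervalIntegrable_log'
  have i2 := intervalIntegrable_sq_mul_div_one_add_pow_four intervalIntegrable_log'
  have h1 := integral_log_mul_div_one_sub norm_theta.le
  have h2 := integral_log_mul_div_one_sub (z := -theta) (by rw [norm_neg, norm_theta])
  have i1' : IntervalIntegrable (fun t : ℝ => ((Real.log t / (1 + t ^ 4) : ℝ) : ℂ)) volume 0 1 :=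
    ⟨i1.1.ofReal, i1.2.ofReal⟩
  have i2' : IntervalIntegrable (fun t : ℝ => ((t ^ 2 * Real.log t / (1 + t ^ 4) : ℝ) : ℂ))
      volume 0 1 := ⟨i2.1.ofReal, i2.2.ofReal⟩
  -- From θ/(1-tθ) + θ/(1+tθ) = 2θ/(1-it²) = 2θ(1+it²)/(1+t⁴). Real and imaginary parts then give
  -- the difference and the sum of the two integrals.
  have key : 2 * theta * ((intQuartic Real.log : ℂ) + Complex.I * (intSqQuartic Real.log : ℂ)) =
      -(dilog theta - dilog (-theta)) := by
    rw [neg_sub', ← h1, sub_neg_eq_add, ← neg_neg (dilog (-theta)), ← h2, ← sub_eq_add_neg,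
      ← integral_sub (i _ theta_sq) (i _ hneg), intQuartic, intSqQuartic, ← intervalIntegral.integral_ofReal,
      ← intervalIntegral.integral_ofReal, ← intervalIntegral.integral_const_mul,
      ← integral_add i1' (i2'.const_mul _), ← intervalIntegral.integral_const_mul]
    refine integral_congr fun t _ => ?_
    have n1 := hn theta theta_sq t
    have n2 := hn (-theta) hneg t
    have n3 : (1 + (t : ℂ) ^ 4) ≠ 0 := by
      have : (1 + t ^ 4 : ℝ) ≠ 0 := by positivity
      exact_mod_cast this
    have e : (1 - (t : ℂ) * theta) * (1 - t * -theta) * (1 + Complex.I * t ^ 2) = 1 + (t : ℂ) ^ 4 := by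
      linear_combination (-(t : ℂ) ^ 2 * (1 + Complex.I * t ^ 2)) * theta_sq -
        (t : ℂ) ^ 4 * Complex.I_sq
    push_cast
    have n5 : theta * (1 - (t : ℂ) * -theta) - (1 - t * theta) * -theta = 2 * theta := by ring
    rw [← mul_sub, div_sub_div _ _ n1 n2, n5]
    generalize (1 - (t : ℂ) * theta) * (1 - t * -theta) = p at e
    rw [← e] at n3 ⊢
    have n4 : (1 + Complex.I * (t : ℂ) ^ 2) ≠ 0 := right_ne_zero_of_mul n3
    have n6 : p ≠ 0 := left_ne_zero_of_mul n3
    field_simp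
  have kr := congrArg Complex.re key
  have ki := congrArg Complex.im key
  have hX : (dilog theta - dilog (-theta)).re = Real.pi ^ 2 / 8 := by
    rw [Complex.sub_re, re_dilog_theta, re_dilog_neg_theta]; ring
  have hY := im_dilog_theta_sub
  rw [Complex.neg_re, hX] at kr
  rw [Complex.neg_im, hY] at ki
  simp [theta_re, theta_im] at kr ki
  have hs0 : √(2 : ℝ) ≠ 0 := by positivity
  constructor
  · apply mul_left_cancel₀ hs0
    linear_combination kr + (Real.pi ^ 2 / 16) * hs
  · apply mul_left_cancel₀ hs0
    linear_combination ki

theorem intTwoSub_one : intTwoSub (fun _ => 1) = Real.log (1 + √2) / √2 := by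
  have hs : √(2 : ℝ) ^ 2 = 2 := Real.sq_sqrt (by norm_num)
  have hs1 : 1 < √(2 : ℝ) := Real.one_lt_sqrt_two
  have key := integral_eq_of_antideriv (a := 0) (b := 1) (f := fun y => 1 / (2 - y ^ 2))
    (fun y => (Real.log (√2 + y) - Real.log (√2 - y)) / (2 * √2)) zero_le_one ?_ ?_ ?_
  · rw [intTwoSub, key]
    have e : Real.log (√2 - 1) = -Real.log (1 + √2) := log_rho
    rw [e, add_comm √2 1]
    simp
    field_simp
    ring
  · intro y hy
    have p1 : √2 + y ≠ 0 := by linarith [hy.1]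
    have p2 : √2 - y ≠ 0 := by linarith [hy.2]
    apply ContinuousAt.continuousWithinAt
    exact ((ContinuousAt.log (by fun_prop) p1).sub (ContinuousAt.log (by fun_prop) p2)).div_const _
  · intro y hy
    have p1 : √2 + y ≠ 0 := by linarith [hy.1]
    have p2 : √2 - y ≠ 0 := by linarith [hy.2]
    have d1 : HasDerivAt (fun y : ℝ => √2 + y) 1 y := (hasDerivAt_id y).const_add _
    have d2 : HasDerivAt (fun y : ℝ => √2 - y) (-1) y := (hasDerivAt_id y).const_sub _
    refine (((d1.log p1).sub (d2.log p2)).div_const (2 * √2)).congr_deriv ?_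
    have e : 2 - y ^ 2 = (√2 + y) * (√2 - y) := by linear_combination -hs
    rw [e]
    field_simp
    ring
  · exact intervalIntegrable_div_two_sub_sq intervalIntegrable_const

/-- The substitution `x = 2y / (1 + y²)`. -/
theorem integral_comp_two_mul_div {g : ℝ → ℝ} (hg : ContinuousOn g (Set.Ioo 0 1))
    (hgi : IntervalIntegrable g volume 0 1)
    (hi : IntervalIntegrable (fun y => g (2 * y / (1 + y ^ 2)) * ((1 - y ^ 2) / (1 + y ^ 4)))
      volume 0 1) :
    ∫ y in (0 : ℝ)..1, g (2 * y / (1 + y ^ 2)) * ((1 - y ^ 2) / (1 + y ^ 4)) = intTwoSub g := by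
  have hc : Continuous fun y : ℝ => 2 * y / (1 + y ^ 2) :=
    Continuous.div (by fun_prop) (by fun_prop) fun y => by positivity
  have hmem : ∀ y ∈ Set.Icc (0 : ℝ) 1, 2 * y / (1 + y ^ 2) ∈ Set.Icc (0 : ℝ) 1 := fun y hy => by
    refine ⟨div_nonneg (by linarith [hy.1]) (by positivity), ?_⟩
    rw [div_le_one (by positivity)]; nlinarith [sq_nonneg (1 - y)]
  have hmem' : ∀ y ∈ Set.Ioo (0 : ℝ) 1, 2 * y / (1 + y ^ 2) ∈ Set.Ioo (0 : ℝ) 1 := fun y hy => by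
    refine ⟨div_pos (by linarith [hy.1]) (by positivity), ?_⟩
    rw [div_lt_one (by positivity)]; nlinarith [hy.2, mul_pos (sub_pos.mpr hy.2) (sub_pos.mpr hy.2)]
  have e : ∀ y : ℝ, g (2 * y / (1 + y ^ 2)) * ((1 - y ^ 2) / (1 + y ^ 4)) =
      ((fun x => g x / (2 - x ^ 2)) ∘ fun y => 2 * y / (1 + y ^ 2)) y *
        (2 * (1 - y ^ 2) / (1 + y ^ 2) ^ 2) := fun y => by
    have h1 : 1 + y ^ 2 ≠ 0 := by positivity
    have h2 : 1 + y ^ 4 ≠ 0 := by positivity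
    have h3 : 2 - (2 * y / (1 + y ^ 2)) ^ 2 = 2 * (1 + y ^ 4) / (1 + y ^ 2) ^ 2 := by
      field_simp; ring
    simp only [Function.comp, h3]
    field_simp
  have key := integral_comp_mul_deriv''' (a := 0) (b := 1) (f := fun y : ℝ => 2 * y / (1 + y ^ 2))
    (f' := fun y => 2 * (1 - y ^ 2) / (1 + y ^ 2) ^ 2) (g := fun x => g x / (2 - x ^ 2))
    hc.continuousOn ?_ ?_ ?_ ?_
  · simp only [← e] at key
    rw [key, intTwoSub]
    norm_num
  · intro y _
    have d1 : HasDerivAt (fun y : ℝ => 2 * y) 2 y := by simpa using (hasDerivAt_id y).const_mul 2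
    have d2 : HasDerivAt (fun y : ℝ => 1 + y ^ 2) (2 * y) y := by
      simpa using (hasDerivAt_pow 2 y).const_add 1
    refine (d1.div d2 (by positivity)).hasDerivWithinAt.congr_deriv ?_
    congr 1; ring
  · rintro x ⟨y, hy, rfl⟩
    rw [min_eq_left zero_le_one, max_eq_right zero_le_one] at hy
    have hx := hmem' y hy
    have hx2 := two_sub_sq_pos (Set.Ioo_subset_Icc_self hx)
    exact ((hg.continuousAt (isOpen_Ioo.mem_nhds hx)).div (by fun_prop) hx2.ne').continuousWithinAt
  · have := intervalIntegrable_div_two_sub_sq hgi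
    rw [intervalIntegrable_iff_integrableOn_Icc_of_le zero_le_one] at this
    refine this.mono_set ?_
    rintro x ⟨y, hy, rfl⟩
    rw [Set.uIcc_of_le zero_le_one] at hy
    exact hmem y hy
  · simp only [← e]
    rw [intervalIntegrable_iff_integrableOn_Icc_of_le zero_le_one] at hi
    rwa [Set.uIcc_of_le zero_le_one]

theorem integral_one_sub_sq_quartic {h : ℝ → ℝ} (hh : IntervalIntegrable h volume 0 1) :
    ∫ y in (0 : ℝ)..1, h y * ((1 - y ^ 2) / (1 + y ^ 4)) = intQuartic h - intSqQuartic h := by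
  rw [intQuartic, intSqQuartic, ← integral_sub (intervalIntegrable_div_one_add_pow_four hh)
    (intervalIntegrable_sq_mul_div_one_add_pow_four hh)]
  congr 1; ext y; ring

theorem integral_one_add_sq_quartic {h : ℝ → ℝ} (hh : IntervalIntegrable h volume 0 1) :
    ∫ y in (0 : ℝ)..1, h y * ((1 + y ^ 2) / (1 + y ^ 4)) = intQuartic h + intSqQuartic h := by
  rw [intQuartic, intSqQuartic, ← integral_add (intervalIntegrable_div_one_add_pow_four hh)
    (intervalIntegrable_sq_mul_div_one_add_pow_four hh)]
  congr 1; ext y; ring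

theorem intervalIntegrable_mul_quartic {h p : ℝ → ℝ} (hh : IntervalIntegrable h volume 0 1)
    (hp : Continuous p) : IntervalIntegrable (fun y => h y * (p y / (1 + y ^ 4))) volume 0 1 :=
  hh.mul_continuousOn
    (hp.div (by fun_prop) fun y => by positivity : Continuous fun y => p y / (1 + y ^ 4)).continuousOn

theorem quartic_one_sub : intQuartic (fun _ => 1) - intSqQuartic (fun _ => 1) =
    Real.log (1 + √2) / √2 := by
  rw [← intTwoSub_one, ← integral_one_sub_sq_quartic intervalIntegrable_const,
    ← integral_comp_two_mul_div (g := fun _ => 1) continuousOn_const intervalIntegrable_const]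
  exact intervalIntegrable_mul_quartic intervalIntegrable_const (by fun_prop)

section Linear
variable {f g : ℝ → ℝ}

theorem intTwoSub_sub (hf : IntervalIntegrable f volume 0 1)
    (hg : IntervalIntegrable g volume 0 1) (c : ℝ) :
    intTwoSub (fun y => f y - c * g y) = intTwoSub f - c * intTwoSub g := by
  rw [intTwoSub, intTwoSub, intTwoSub, ← intervalIntegral.integral_const_mul,
    ← integral_sub (intervalIntegrable_div_two_sub_sq hf)
      ((intervalIntegrable_div_two_sub_sq hg).const_mul c)]
  congr 1; ext y; ring

theorem intQuartic_sub (hf : IntervalIntegrable f volume 0 1)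
    (hg : IntervalIntegrable g volume 0 1) (c : ℝ) :
    intQuartic (fun y => f y - c * g y) = intQuartic f - c * intQuartic g := by
  rw [intQuartic, intQuartic, intQuartic, ← intervalIntegral.integral_const_mul,
    ← integral_sub (intervalIntegrable_div_one_add_pow_four hf)
      ((intervalIntegrable_div_one_add_pow_four hg).const_mul c)]
  congr 1; ext y; ring

theorem intSqQuartic_sub (hf : IntervalIntegrable f volume 0 1)
    (hg : IntervalIntegrable g volume 0 1) (c : ℝ) :
    intSqQuartic (fun y => f y - c * g y) = intSqQuartic f - c * intSqQuartic g := by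
  rw [intSqQuartic, intSqQuartic, intSqQuartic, ← intervalIntegral.integral_const_mul,
    ← integral_sub (intervalIntegrable_sq_mul_div_one_add_pow_four hf)
      ((intervalIntegrable_sq_mul_div_one_add_pow_four hg).const_mul c)]
  congr 1; ext y; ring

end Linear

/-- Under x = 2y/(1+y²), 1-x² becomes ((1-y²)/(1+y²))². In log(1-x²) - 2 log x the terms log(1+y²)
cancel, leaving twice log(1-y²) - log y - log 2. -/
theorem quartic_log_one_sub_sq_sub :
    2 * (intQuartic (fun y => Real.log (1 - y ^ 2)) - intSqQuartic (fun y => Real.log (1 - y ^ 2))) =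
      intTwoSub (fun y => Real.log (1 - y ^ 2)) - 2 * intTwoSub Real.log
      + 2 * (intQuartic Real.log - intSqQuartic Real.log)
      + 2 * Real.log 2 * (Real.log (1 + √2) / √2) := by
  have hK := intervalIntegrable_log_one_sub_sq
  have hJ : IntervalIntegrable Real.log volume 0 1 := intervalIntegrable_log'
  have h1 : IntervalIntegrable (fun _ : ℝ => (1 : ℝ)) volume 0 1 := intervalIntegrable_const
  have i0 := (hK.sub (hJ.const_mul 1)).sub (h1.const_mul (Real.log 2))
  have e : Set.EqOn (fun y : ℝ => 2 * ((Real.log (1 - y ^ 2) - 1 * Real.log y - Real.log 2 * 1) *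
        ((1 - y ^ 2) / (1 + y ^ 4))))
      (fun y : ℝ => (fun x => Real.log (1 - x ^ 2) - 2 * Real.log x) (2 * y / (1 + y ^ 2)) *
        ((1 - y ^ 2) / (1 + y ^ 4))) (Set.Ioo 0 1) := fun y hy => by
    have p0 : y ≠ 0 := hy.1.ne'
    have p1 : 1 - y ^ 2 ≠ 0 := by nlinarith [hy.1, hy.2]
    have p2 : 1 + y ^ 2 ≠ 0 := by positivity
    have e1 : 1 - (2 * y / (1 + y ^ 2)) ^ 2 = ((1 - y ^ 2) / (1 + y ^ 2)) ^ 2 := by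
      field_simp; ring
    simp only [e1]
    rw [Real.log_pow, Real.log_div p1 p2, Real.log_div (by positivity) p2,
      Real.log_mul two_ne_zero p0]
    push_cast
    ring
  have key := integral_comp_two_mul_div (g := fun x => Real.log (1 - x ^ 2) - 2 * Real.log x) ?_ ?_ ?_
  · rw [intTwoSub_sub hK hJ, ← integral_congr_Ioo_of_le zero_le_one e,
      intervalIntegral.integral_const_mul, integral_one_sub_sq_quartic i0,
      intQuartic_sub (hK.sub (hJ.const_mul 1)) h1, intSqQuartic_sub (hK.sub (hJ.const_mul 1)) h1,
      intQuartic_sub hK hJ, intSqQuartic_sub hK hJ] at key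
    have := quartic_one_sub
    linear_combination key + 2 * Real.log 2 * this
  · intro x hx
    have p1 : 1 - x ^ 2 ≠ 0 := by nlinarith [hx.1, hx.2]
    have c1 : ContinuousAt (fun x : ℝ => Real.log (1 - x ^ 2)) x :=
      ContinuousAt.log (by fun_prop) p1
    exact (c1.sub ((Real.continuousAt_log hx.1.ne').const_mul 2)).continuousWithinAt
  · exact hK.sub (hJ.const_mul 2)
  · refine ((intervalIntegrable_mul_quartic i0 (p := fun y => 1 - y ^ 2)
      (by fun_prop)).const_mul 2).congr_uIoo ?_
    rw [Set.uIoo_of_le zero_le_one]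
    exact e

theorem hasDerivAt_arctan_add (y : ℝ) :
    HasDerivAt (fun y => Real.arctan (√2 * y - 1) + Real.arctan (√2 * y + 1))
      (√2 * ((1 + y ^ 2) / (1 + y ^ 4))) y := by
  have hs : √(2 : ℝ) ^ 2 = 2 := Real.sq_sqrt (by norm_num)
  have d0 : HasDerivAt (fun y : ℝ => √2 * y) √2 y := by
    simpa using (hasDerivAt_id y).const_mul √2
  refine ((d0.sub_const 1).arctan.add (d0.add_const 1).arctan).congr_deriv ?_
  have e : (1 + (√2 * y - 1) ^ 2) * (1 + (√2 * y + 1) ^ 2) = 4 * (1 + y ^ 4) := by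
    linear_combination (y ^ 4 * (√2 ^ 2 + 2)) * hs
  have n1 : 1 + (√2 * y - 1) ^ 2 ≠ 0 := by positivity
  have n2 : 1 + (√2 * y + 1) ^ 2 ≠ 0 := by positivity
  have n3 : 1 + y ^ 4 ≠ 0 := by positivity
  have e2 : 1 / (1 + (√2 * y - 1) ^ 2) + 1 / (1 + (√2 * y + 1) ^ 2) = (1 + y ^ 2) / (1 + y ^ 4) := by
    rw [div_add_div _ _ n1 n2, e, div_eq_div_iff (by positivity) n3]
    linear_combination (2 * y ^ 2 * (1 + y ^ 4)) * hs
  rw [← add_mul, e2, mul_comm]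

theorem arctan_add_one : Real.arctan (√2 * 1 - 1) + Real.arctan (√2 * 1 + 1) = Real.pi / 2 := by
  have h := Real.arctan_inv_of_pos rho_pos
  rw [rho_inv, rho] at h
  rw [show √2 * 1 + 1 = √2 - 1 + 2 by ring, h, mul_one]
  ring

theorem arctan_add_zero : Real.arctan (√2 * 0 - 1) + Real.arctan (√2 * 0 + 1) = 0 := by
  rw [mul_zero, zero_sub, zero_add, Real.arctan_neg]; ring

theorem quartic_one_add : intQuartic (fun _ => 1) + intSqQuartic (fun _ => 1) =
    Real.pi / (2 * √2) := by
  have h1 : IntervalIntegrable (fun _ : ℝ => (1 : ℝ)) volume 0 1 := intervalIntegrable_const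
  have key := integral_eq_sub_of_hasDerivAt (a := 0) (b := 1)
    (fun y _ => hasDerivAt_arctan_add y) ?_
  · rw [intervalIntegral.integral_const_mul, arctan_add_one, arctan_add_zero] at key
    rw [← integral_one_add_sq_quartic h1, eq_div_iff (by positivity)]
    simp only [one_mul]
    linear_combination 2 * key
  · have := (intervalIntegrable_mul_quartic h1 (p := fun y => 1 + y ^ 2) (by fun_prop)).const_mul √2
    simpa only [one_mul] using this

/-- For the angle ψ, a primitive of √2(1+y²)/(1+y⁴), this says tan ψ = √2 y/(1-y²) without dividing
at y = 1; the common factor c drops out of log sin ψ - log cos ψ. -/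
theorem sin_cos_arctan_add (y : ℝ) :
    ∃ c : ℝ, 0 < c ∧
      Real.sin (Real.arctan (√2 * y - 1) + Real.arctan (√2 * y + 1)) = c * (√2 * y) ∧
      Real.cos (Real.arctan (√2 * y - 1) + Real.arctan (√2 * y + 1)) = c * (1 - y ^ 2) := by
  have hs : √(2 : ℝ) ^ 2 = 2 := Real.sq_sqrt (by norm_num)
  refine ⟨2 * (Real.cos (Real.arctan (√2 * y - 1)) * Real.cos (Real.arctan (√2 * y + 1))), ?_, ?_, ?_⟩
  · have := Real.cos_arctan_pos (√2 * y - 1)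
    have := Real.cos_arctan_pos (√2 * y + 1)
    positivity
  · rw [Real.sin_add, Real.sin_arctan, Real.sin_arctan, Real.cos_arctan, Real.cos_arctan]
    ring
  · rw [Real.cos_add, Real.sin_arctan, Real.sin_arctan, Real.cos_arctan, Real.cos_arctan]
    linear_combination (-y ^ 2 * (1 / √(1 + (√2 * y - 1) ^ 2)) * (1 / √(1 + (√2 * y + 1) ^ 2))) * hs

/-- In the variable ψ, log y - log(1-y²) + (log 2)/2 is log tan ψ, and y ∈ [0,1] becomes ψ ∈
[0,π/2], where log tan ψ integrates to 0 by ψ ↦ π/2-ψ. -/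
theorem quartic_log_one_sub_sq_add :
    intQuartic (fun y => Real.log (1 - y ^ 2)) + intSqQuartic (fun y => Real.log (1 - y ^ 2)) =
      intQuartic Real.log + intSqQuartic Real.log + Real.pi * Real.log 2 / (4 * √2) := by
  have hK := intervalIntegrable_log_one_sub_sq
  have hJ : IntervalIntegrable Real.log volume 0 1 := intervalIntegrable_log'
  have h1 : IntervalIntegrable (fun _ : ℝ => (1 : ℝ)) volume 0 1 := intervalIntegrable_const
  have hg : ∀ a b : ℝ, IntervalIntegrable (fun ψ => Real.log (Real.sin ψ) - Real.log (Real.cos ψ))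
    volume a b := fun a b => intervalIntegrable_log_sin.sub intervalIntegrable_log_cos
  have hg0 : ∫ ψ in (0 : ℝ)..(Real.pi / 2), (Real.log (Real.sin ψ) - Real.log (Real.cos ψ)) = 0 := by
    have h := integral_sub (a := 0) (b := Real.pi / 2) (μ := volume)
      intervalIntegrable_log_sin intervalIntegrable_log_cos
    simp only [Function.comp] at h
    rw [h, sub_eq_zero]
    have := integral_comp_sub_left (a := 0) (b := Real.pi / 2)
      (fun x => Real.log (Real.sin x)) (Real.pi / 2)
    simp only [Real.sin_pi_div_two_sub, sub_self, sub_zero] at this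
    exact this.symm
  have i0 := (hK.sub (hJ.const_mul 1)).sub (h1.const_mul (Real.log 2 / 2))
  have e : Set.EqOn (fun y : ℝ => -√2 * ((Real.log (1 - y ^ 2) - 1 * Real.log y - Real.log 2 / 2 * 1) *
        ((1 + y ^ 2) / (1 + y ^ 4))))
      (fun y : ℝ => ((fun ψ => Real.log (Real.sin ψ) - Real.log (Real.cos ψ)) ∘
        fun y => Real.arctan (√2 * y - 1) + Real.arctan (√2 * y + 1)) y *
        (√2 * ((1 + y ^ 2) / (1 + y ^ 4)))) (Set.Ioo 0 1) := fun y hy => by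
    obtain ⟨c, hc, h2, h3⟩ := sin_cos_arctan_add y
    have p1 : 1 - y ^ 2 ≠ 0 := by nlinarith [hy.1, hy.2]
    simp only [Function.comp, h2, h3]
    rw [Real.log_mul hc.ne' (mul_ne_zero sqrt_two_ne_zero hy.1.ne'), Real.log_mul hc.ne' p1,
      Real.log_mul sqrt_two_ne_zero hy.1.ne', log_sqrt_two]
    ring
  have key := integral_comp_mul_deriv''' (a := 0) (b := 1)
    (f := fun y => Real.arctan (√2 * y - 1) + Real.arctan (√2 * y + 1))
    (f' := fun y => √2 * ((1 + y ^ 2) / (1 + y ^ 4)))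
    (g := fun ψ => Real.log (Real.sin ψ) - Real.log (Real.cos ψ)) ?_ ?_ ?_ ?_ ?_
  · rw [arctan_add_one, arctan_add_zero, hg0, ← integral_congr_Ioo_of_le zero_le_one e,
      intervalIntegral.integral_const_mul, integral_one_add_sq_quartic i0,
      intQuartic_sub (hK.sub (hJ.const_mul 1)) h1, intSqQuartic_sub (hK.sub (hJ.const_mul 1)) h1,
      intQuartic_sub hK hJ, intSqQuartic_sub hK hJ] at key
    have key' := (mul_eq_zero.mp key).resolve_left (neg_ne_zero.mpr sqrt_two_ne_zero)
    have := quartic_one_add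
    have e2 : Real.pi * Real.log 2 / (4 * √2) = Real.log 2 / 2 * (Real.pi / (2 * √2)) := by
      have := sqrt_two_ne_zero
      field_simp
      ring
    rw [e2]
    linear_combination key' + Real.log 2 / 2 * this
  · exact fun y _ => (hasDerivAt_arctan_add y).continuousAt.continuousWithinAt
  · exact fun y _ => (hasDerivAt_arctan_add y).hasDerivWithinAt
  · rintro ψ ⟨y, hy, rfl⟩
    rw [min_eq_left zero_le_one, max_eq_right zero_le_one] at hy
    obtain ⟨c, hc, h2, h3⟩ := sin_cos_arctan_add y
    have p1 : 1 - y ^ 2 ≠ 0 := by nlinarith [hy.1, hy.2]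
    refine (ContinuousAt.sub (ContinuousAt.log (by fun_prop) ?_)
      (ContinuousAt.log (by fun_prop) ?_)).continuousWithinAt
    · rw [h2]; exact mul_ne_zero hc.ne' (mul_ne_zero sqrt_two_ne_zero hy.1.ne')
    · rw [h3]; exact mul_ne_zero hc.ne' p1
  · have := hg (-Real.pi) Real.pi
    rw [intervalIntegrable_iff_integrableOn_Icc_of_le (by linarith [Real.pi_pos])] at this
    refine this.mono_set ?_
    rintro ψ ⟨y, hy, rfl⟩
    have a1 := Real.neg_pi_div_two_lt_arctan (√2 * y - 1)
    have a2 := Real.arctan_lt_pi_div_two (√2 * y - 1)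
    have a3 := Real.neg_pi_div_two_lt_arctan (√2 * y + 1)
    have a4 := Real.arctan_lt_pi_div_two (√2 * y + 1)
    constructor <;> simp only <;> linarith
  · rw [Set.uIcc_of_le zero_le_one, ← intervalIntegrable_iff_integrableOn_Icc_of_le zero_le_one]
    refine ((intervalIntegrable_mul_quartic i0 (p := fun y => 1 + y ^ 2)
      (by fun_prop)).const_mul (-√2)).congr_uIoo ?_
    rw [Set.uIoo_of_le zero_le_one]
    exact e

/-! ### Real parts of Li₂ along curves, and Re Li_{1,1}(i,θ). -/

theorem HasDerivAt.complex_re {f : ℝ → ℂ} {f' : ℂ} {x : ℝ} (h : HasDerivAt f f' x) :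
    HasDerivAt (fun t => (f t).re) f'.re x :=
  Complex.reCLM.hasFDerivAt.comp_hasDerivAt x h

theorem HasDerivAt.complex_im {f : ℝ → ℂ} {f' : ℂ} {x : ℝ} (h : HasDerivAt f f' x) :
    HasDerivAt (fun t => (f t).im) f'.im x :=
  Complex.imCLM.hasFDerivAt.comp_hasDerivAt x h

theorem HasDerivAt.dilog {f : ℝ → ℂ} {f' : ℂ} {x : ℝ} (h : HasDerivAt f f' x)
    (h1 : 1 - f x ∈ Complex.slitPlane) (h0 : f x ≠ 0) :
    HasDerivAt (fun t => dilog (f t)) (-(Complex.log (1 - f x) / f x) * f') x :=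
  (hasDerivAt_dilog h1 h0).comp x h

theorem log_mul_exp {r φ : ℝ} (hr : 0 < r) (h1 : -Real.pi < φ) (h2 : φ ≤ Real.pi) :
    Complex.log (r * Complex.exp (φ * Complex.I)) = Real.log r + φ * Complex.I := by
  rw [Complex.ofReal_log hr.le]
  have hr' : (r : ℂ) ≠ 0 := by exact_mod_cast hr.ne'
  conv_lhs => rw [← Complex.exp_log hr', ← Complex.exp_add]
  rw [Complex.log_exp]
  · simpa [← Complex.ofReal_log hr.le] using h1
  · simpa [← Complex.ofReal_log hr.le] using h2

/-- On the line `Re z = 1/2`, where `1 - z` is the conjugate of `z`, the real part of the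
dilogarithm is elementary. -/
theorem re_dilog_half_add {y : ℝ} (hy : 0 ≤ y) :
    (dilog (1 / 2 + y * Complex.I)).re = Real.pi ^ 2 / 12 -
      ((Complex.log (1 / 2 + y * Complex.I)).re ^ 2 +
        (Complex.log (1 / 2 + y * Complex.I)).im ^ 2) / 2 := by
  have hre : ∀ y : ℝ, (1 / 2 + y * Complex.I : ℂ).re = 1 / 2 := fun y => by simp
  have hm : ∀ y : ℝ, (1 / 2 + y * Complex.I : ℂ) ∈ Complex.slitPlane := fun y => by
    rw [Complex.mem_slitPlane_iff]; left; rw [hre]; norm_num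
  have hconj : ∀ y : ℝ, 1 - (1 / 2 + y * Complex.I : ℂ) =
      (starRingEnd ℂ) (1 / 2 + y * Complex.I) := fun y => by
    apply Complex.ext
    · simp; norm_num
    · simp
  have hm' : ∀ y : ℝ, 1 - (1 / 2 + y * Complex.I : ℂ) ∈ Complex.slitPlane := fun y => by
    rw [Complex.mem_slitPlane_iff]; left; rw [Complex.sub_re, hre]; norm_num
  have d0 : ∀ y : ℝ, HasDerivAt (fun t : ℝ => (1 / 2 + t * Complex.I : ℂ)) Complex.I y := fun y => by
    have : HasDerivAt (fun t : ℂ => (1 / 2 + t * Complex.I : ℂ)) Complex.I (y : ℂ) := by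
      simpa using ((hasDerivAt_id (y : ℂ)).mul_const Complex.I).const_add (1 / 2)
    exact this.comp_ofReal
  have d : ∀ y : ℝ, HasDerivAt (fun t : ℝ => (dilog (1 / 2 + t * Complex.I)).re +
      ((Complex.log (1 / 2 + t * Complex.I)).re ^ 2 +
        (Complex.log (1 / 2 + t * Complex.I)).im ^ 2) / 2) 0 y := fun y => by
    have d1 := ((d0 y).dilog (hm' y) (Complex.slitPlane_ne_zero (hm y))).complex_re
    have dl := HasDerivAt.clog_real (d0 y) (hm y)
    have d2 := ((dl.complex_re.pow 2).add (dl.complex_im.pow 2)).div_const 2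
    refine (d1.add d2).congr_deriv ?_
    -- The dilogarithm contributes -Re(conj(log z)·(log z)'), which cancels the derivative of |log
    -- z|²/2.
    rw [hconj, Complex.log_conj _ (Complex.slitPlane_arg_ne_pi (hm y)),
      show -((starRingEnd ℂ) (Complex.log (1 / 2 + y * Complex.I)) / (1 / 2 + y * Complex.I)) *
        Complex.I = -((starRingEnd ℂ) (Complex.log (1 / 2 + y * Complex.I)) *
        (Complex.I / (1 / 2 + y * Complex.I))) by ring]
    simp only [Complex.neg_re, Complex.mul_re, Complex.conj_re, Complex.conj_im]
    norm_num
    ring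
  have h := eq_of_hasDerivAt_zero hy (fun t _ => (d t).continuousAt.continuousWithinAt)
    (fun t _ => d t)
  have e : (dilog (1 / 2)).re = Real.pi ^ 2 / 12 - Real.log 2 ^ 2 / 2 := by
    rw [← reDilog_half, reDilog]; norm_num
  have e2 : Complex.log (1 / 2) = ((-Real.log 2 : ℝ) : ℂ) := by
    rw [← Real.log_inv, Complex.ofReal_log (by norm_num)]; norm_num
  simp only [Complex.ofReal_zero, zero_mul, add_zero, e, e2, Complex.ofReal_re,
    Complex.ofReal_im] at h
  linarith

theorem norm_one_sub_mul_theta {x : ℝ} (hx : 0 < x) :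
    ‖1 - (x : ℂ) * theta‖ = x * ‖1 - ((x⁻¹ : ℝ) : ℂ) * theta‖ := by
  have hs : √(2 : ℝ) ^ 2 = 2 := Real.sq_sqrt (by norm_num)
  rw [← sq_eq_sq₀ (norm_nonneg _) (by positivity), mul_pow, Complex.sq_norm, Complex.sq_norm,
    Complex.normSq_apply, Complex.normSq_apply]
  simp only [Complex.sub_re, Complex.one_re, Complex.re_ofReal_mul, Complex.sub_im, Complex.one_im,
    Complex.im_ofReal_mul, theta_re, theta_im]
  field_simp
  linear_combination (2 * x ^ 2 - 2) * hs

/-- On the ray, only log|1-xθ| enters the derivative of the real part; |1-xθ| = x|1-θ/x| makes the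
total derivative vanish. -/
theorem re_dilog_theta_inversion {x : ℝ} (hx : 1 ≤ x) :
    (dilog (x * theta)).re + (dilog ((x⁻¹ : ℝ) * theta)).re + Real.log x ^ 2 / 2 =
      11 * Real.pi ^ 2 / 96 := by
  have hm : ∀ y : ℝ, 0 < y → 1 - (y : ℂ) * theta ∈ Complex.slitPlane := fun y hy => by
    apply one_sub_mem_slitPlane_of_im
    rw [Complex.im_ofReal_mul, theta_im]; positivity
  have hn : ∀ y : ℝ, 0 < y → (y : ℂ) * theta ≠ 0 := fun y hy =>
    mul_ne_zero (by exact_mod_cast hy.ne') theta_ne_zero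
  have d : ∀ y : ℝ, 0 < y → HasDerivAt (fun y : ℝ => (dilog (y * theta)).re +
      (dilog ((y⁻¹ : ℝ) * theta)).re + Real.log y ^ 2 / 2) 0 y := fun y hy => by
    have hyi : 0 < y⁻¹ := by positivity
    have d1 := ((((hasDerivAt_id y).ofReal_comp).mul_const theta).dilog (hm y hy) (hn y hy)).complex_re
    have d2 := ((((hasDerivAt_inv hy.ne').ofReal_comp).mul_const theta).dilog
      (hm _ hyi) (hn _ hyi)).complex_re
    have d3 := ((Real.hasDerivAt_log hy.ne').pow 2).div_const 2
    refine ((d1.add d2).add d3).congr_deriv ?_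
    have e1 : -(Complex.log (1 - (y : ℂ) * theta) / ((y : ℂ) * theta)) * (((1 : ℝ) : ℂ) * theta) =
        ((-y⁻¹ : ℝ) : ℂ) * Complex.log (1 - (y : ℂ) * theta) := by
      have := theta_ne_zero
      have : (y : ℂ) ≠ 0 := by exact_mod_cast hy.ne'
      push_cast
      field_simp
    have e2 : -(Complex.log (1 - ((y⁻¹ : ℝ) : ℂ) * theta) / (((y⁻¹ : ℝ) : ℂ) * theta)) *
        (((-(y ^ 2)⁻¹ : ℝ) : ℂ) * theta) =
        ((y⁻¹ : ℝ) : ℂ) * Complex.log (1 - ((y⁻¹ : ℝ) : ℂ) * theta) := by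
      have := theta_ne_zero
      have : (y : ℂ) ≠ 0 := by exact_mod_cast hy.ne'
      generalize Complex.log (1 - ((y⁻¹ : ℝ) : ℂ) * theta) = l
      push_cast
      field_simp
    have np : 0 < ‖1 - ((y⁻¹ : ℝ) : ℂ) * theta‖ :=
      norm_pos_iff.mpr (Complex.slitPlane_ne_zero (hm _ hyi))
    simp only [id]
    rw [e1, e2, Complex.re_ofReal_mul, Complex.re_ofReal_mul, Complex.log_re, Complex.log_re,
      norm_one_sub_mul_theta hy, Real.log_mul hy.ne' np.ne']
    field_simp
    ring
  have h := eq_of_hasDerivAt_zero hx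
    (fun t ht => (d t (by linarith [ht.1])).continuousAt.continuousWithinAt)
    (fun t ht => d t (by linarith [ht.1]))
  simp only [Complex.ofReal_one, one_mul, inv_one, Real.log_one, re_dilog_theta] at h
  linarith

/-- Since 2cos φ · e^{iφ} = e^{2iφ} + 1, the left side is e^{iφ} - e^{2iφ}. -/
theorem one_sub_two_cos_mul_exp (φ : ℝ) :
    1 - ((2 * Real.cos φ - 1 : ℝ) : ℂ) * Complex.exp (φ * Complex.I) =
      ((2 * Real.sin (φ / 2) : ℝ) : ℂ) *
        Complex.exp (((3 * φ / 2 - Real.pi / 2 : ℝ) : ℂ) * Complex.I) := by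
  have hEF : Complex.exp ((φ / 2 : ℂ) * Complex.I) * Complex.exp (-(φ / 2 : ℂ) * Complex.I) = 1 := by
    rw [← Complex.exp_add]; simp
  have e1 : Complex.exp (φ * Complex.I) = Complex.exp ((φ / 2 : ℂ) * Complex.I) ^ 2 := by
    rw [← Complex.exp_nat_mul]; congr 1; push_cast; ring
  have e2 : Complex.exp (-φ * Complex.I) = Complex.exp (-(φ / 2 : ℂ) * Complex.I) ^ 2 := by
    rw [← Complex.exp_nat_mul]; congr 1; push_cast; ring
  have e3 : Complex.exp (((3 * φ / 2 - Real.pi / 2 : ℝ) : ℂ) * Complex.I) =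
      Complex.exp ((φ / 2 : ℂ) * Complex.I) ^ 3 * -Complex.I := by
    rw [← Complex.exp_nat_mul, ← Complex.exp_neg_pi_div_two_mul_I, ← Complex.exp_add]
    congr 1; push_cast; ring
  push_cast
  rw [Complex.cos, Complex.sin]
  push_cast at e3
  rw [e3, e1, e2]
  generalize Complex.exp ((φ / 2 : ℂ) * Complex.I) = E at *
  generalize Complex.exp (-(φ / 2 : ℂ) * Complex.I) = F at *
  linear_combination (-E * F - 1 - E ^ 2) * hEF + (F - E) * E ^ 3 * Complex.I_sq

/-- On the curve z = re^{iφ}, r = 2cos φ - 1, one has |1-z|² = 1-r and arg(1-z) = 3φ/2 - π/2. So d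
Re Li₂(z) = ½ dLi₂(r) + (3φ/2 - π/2) dφ. The curve runs from z = ρθ at φ = π/4 to z = 0 at φ = π/3.
-/
theorem re_dilog_rho_mul_theta :
    (dilog (rho * theta)).re = reDilog rho / 2 + Real.pi ^ 2 / 192 := by
  have hpi := Real.pi_pos
  have hsin : ∀ φ ∈ Set.Icc (Real.pi / 4) (Real.pi / 3), 0 < 2 * Real.sin (φ / 2) := fun φ hφ => by
    have := Real.sin_pos_of_pos_of_lt_pi (x := φ / 2) (by linarith [hφ.1]) (by linarith [hφ.2])
    linarith
  have hm : ∀ φ ∈ Set.Icc (Real.pi / 4) (Real.pi / 3),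
      1 - ((2 * Real.cos φ - 1 : ℝ) : ℂ) * Complex.exp (φ * Complex.I) ∈ Complex.slitPlane :=
      fun φ hφ => by
    rw [one_sub_two_cos_mul_exp, Complex.mem_slitPlane_iff]
    left
    rw [Complex.re_ofReal_mul, Complex.exp_ofReal_mul_I_re]
    exact mul_pos (hsin φ hφ) (Real.cos_pos_of_mem_Ioo ⟨by linarith [hφ.1], by linarith [hφ.2]⟩)
  have hlt : ∀ φ ∈ Set.Icc (Real.pi / 4) (Real.pi / 3), 2 * Real.cos φ - 1 < 1 := fun φ hφ => by
    have := Real.cos_lt_cos_of_nonneg_of_le_pi le_rfl (by linarith [hφ.2])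
      (by linarith [hφ.1] : 0 < φ)
    rw [Real.cos_zero] at this
    linarith
  have dc : ∀ φ : ℝ, HasDerivAt (fun φ => 2 * Real.cos φ - 1) (-2 * Real.sin φ) φ := fun φ => by
    have := ((Real.hasDerivAt_cos φ).const_mul 2).sub_const 1
    refine this.congr_deriv (by ring)
  have dz : ∀ φ : ℝ, HasDerivAt
      (fun φ : ℝ => ((2 * Real.cos φ - 1 : ℝ) : ℂ) * Complex.exp (φ * Complex.I))
      (((-2 * Real.sin φ : ℝ) : ℂ) * Complex.exp (φ * Complex.I) +
        ((2 * Real.cos φ - 1 : ℝ) : ℂ) * (Complex.exp (φ * Complex.I) * Complex.I)) φ := fun φ => by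
    have de : HasDerivAt (fun φ : ℝ => Complex.exp (φ * Complex.I))
        (Complex.exp (φ * Complex.I) * Complex.I) φ := by
      have : HasDerivAt (fun w : ℂ => Complex.exp (w * Complex.I))
          (Complex.exp (φ * Complex.I) * Complex.I) (φ : ℂ) := by
        simpa using ((hasDerivAt_id (φ : ℂ)).mul_const Complex.I).cexp
      exact this.comp_ofReal
    exact (dc φ).ofReal_comp.mul de
  have h := eq_of_hasDerivAt_zero (a := Real.pi / 4) (b := Real.pi / 3) (f := fun φ : ℝ =>
    (dilog (((2 * Real.cos φ - 1 : ℝ) : ℂ) * Complex.exp (φ * Complex.I))).re -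
      reDilog (2 * Real.cos φ - 1) / 2 - (3 * φ ^ 2 / 4 - Real.pi * φ / 2)) (by linarith) ?_ ?_
  · have e1 : 2 * Real.cos (Real.pi / 4) - 1 = rho := by
      rw [Real.cos_pi_div_four, rho]; ring
    have e2 : 2 * Real.cos (Real.pi / 3) - 1 = 0 := by rw [Real.cos_pi_div_three]; ring
    have e3 : Complex.exp (((Real.pi / 4 : ℝ) : ℂ) * Complex.I) = theta := by
      rw [theta]; congr 1; push_cast; ring
    have e4 : (dilog 0).re = 0 := by simp [dilog]
    simp only [e1, e2, e3, Complex.ofReal_zero, zero_mul, e4, reDilog_zero] at h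
    linear_combination h
  · intro φ hφ
    apply ContinuousAt.continuousWithinAt
    have c1 : ContinuousAt (fun φ : ℝ =>
        dilog (((2 * Real.cos φ - 1 : ℝ) : ℂ) * Complex.exp (φ * Complex.I))) φ :=
      ContinuousAt.comp (f := fun φ : ℝ =>
        ((2 * Real.cos φ - 1 : ℝ) : ℂ) * Complex.exp (φ * Complex.I))
        (continuousAt_dilog (hm φ hφ)) (dz φ).continuousAt
    have c2 : ContinuousAt (fun φ : ℝ => reDilog (2 * Real.cos φ - 1)) φ :=
      ContinuousAt.comp (f := fun φ : ℝ => 2 * Real.cos φ - 1)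
        (continuousAt_reDilog (hlt φ hφ)) (dc φ).continuousAt
    exact ((Complex.continuous_re.continuousAt.comp c1).sub (c2.div_const 2)).sub (by fun_prop)
  · intro φ hφ
    have hφ' := Set.Ioo_subset_Icc_self hφ
    have ht : 0 < 2 * Real.cos φ - 1 := by
      have := Real.cos_lt_cos_of_nonneg_of_le_pi (by linarith [hφ.1]) (by linarith) hφ.2
      rw [Real.cos_pi_div_three] at this
      linarith
    have hz : ((2 * Real.cos φ - 1 : ℝ) : ℂ) * Complex.exp (φ * Complex.I) ≠ 0 :=
      mul_ne_zero (by exact_mod_cast ht.ne') (Complex.exp_ne_zero _)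
    have d1 := ((dz φ).dilog (hm φ hφ') hz).complex_re
    have d2 := ((hasDerivAt_reDilog (hlt φ hφ') ht.ne').comp φ (dc φ)).div_const 2
    have d3 : HasDerivAt (fun φ : ℝ => 3 * φ ^ 2 / 4 - Real.pi * φ / 2)
        (3 * φ / 2 - Real.pi / 2) φ := by
      refine ((((hasDerivAt_pow 2 φ).const_mul 3).div_const 4).sub
        (((hasDerivAt_id φ).const_mul Real.pi).div_const 2)).congr_deriv ?_
      push_cast; ring
    refine ((d1.sub d2).sub d3).congr_deriv ?_
    rw [one_sub_two_cos_mul_exp, log_mul_exp (hsin φ hφ') (by linarith [hφ.1]) (by linarith [hφ.2])]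
    have e1 : 1 - (2 * Real.cos φ - 1) = (2 * Real.sin (φ / 2)) ^ 2 := by
      have := Real.cos_sq' (φ / 2)
      have h2 := Real.cos_sq (φ / 2)
      rw [mul_div_cancel₀ _ (two_ne_zero)] at h2
      linarith
    rw [e1, Real.log_pow]
    generalize Real.log (2 * Real.sin (φ / 2)) = l
    have e2 : -(((l : ℂ) + ((3 * φ / 2 - Real.pi / 2 : ℝ) : ℂ) * Complex.I) /
        (((2 * Real.cos φ - 1 : ℝ) : ℂ) * Complex.exp (φ * Complex.I))) *
        (((-2 * Real.sin φ : ℝ) : ℂ) * Complex.exp (φ * Complex.I) +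
        ((2 * Real.cos φ - 1 : ℝ) : ℂ) * (Complex.exp (φ * Complex.I) * Complex.I)) =
        -(((l : ℂ) + ((3 * φ / 2 - Real.pi / 2 : ℝ) : ℂ) * Complex.I) *
        (((-2 * Real.sin φ / (2 * Real.cos φ - 1) : ℝ) : ℂ) + Complex.I)) := by
      have n1 := Complex.exp_ne_zero (φ * Complex.I)
      have n2 : ((2 * Real.cos φ - 1 : ℝ) : ℂ) ≠ 0 := by exact_mod_cast ht.ne'
      rw [Complex.ofReal_div]
      field_simp
    rw [e2]
    simp only [Complex.neg_re, Complex.mul_re, Complex.add_re, Complex.add_im, Complex.ofReal_re,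
      Complex.ofReal_im, Complex.mul_im, Complex.I_re, Complex.I_im]
    push_cast
    field_simp
    ring

/-- An explicit primitive reduces the double polylogarithm to Li₂ at v(1) and v(0). Here v(0) lies
on Re z = 1/2, and v(1) = θ/ρ is carried by inversion to ρθ. -/
theorem reLi11_eq : reLi11 = 3 * Real.log 2 ^ 2 / 32 + Real.log 2 * Real.log (1 + √2) / 8 -
    Real.log (1 + √2) ^ 2 / 8 + 7 * Real.pi ^ 2 / 384 - reDilog rho / 2 := by
  have hpi := Real.pi_pos
  have hs : √(2 : ℝ) ^ 2 = 2 := Real.sq_sqrt (by norm_num)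
  have hs1 : 1 < √(2 : ℝ) := Real.one_lt_sqrt_two
  have hs2 : √(2 : ℝ) < 2 := by nlinarith
  have hsC : ((√2 : ℝ) : ℂ) ^ 2 = 2 := by exact_mod_cast hs
  set κ : ℝ := (1 + √2) / 2 with hκ
  have hκ0 : 0 < κ := by positivity
  -- the points `1 + t τ` and `v t = (1 + t τ) / (1 + τ³)` with `τ = -i θ`
  have hτ : ∀ t : ℝ, 1 - (t : ℂ) * (Complex.I * theta) =
      1 + t * ((√2 / 2 : ℝ) - (√2 / 2 : ℝ) * Complex.I) := fun t => by
    rw [theta_eq]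
    linear_combination (-(t : ℂ) * (√2 / 2 : ℝ)) * Complex.I_sq
  set u : ℝ → ℂ := fun t => 1 + t * ((√2 / 2 : ℝ) - (√2 / 2 : ℝ) * Complex.I) with hu
  set v : ℝ → ℂ := fun t => 1 / 2 + κ * Complex.I + t * (κ + 1 / 2 * Complex.I) with hv
  have hvre : ∀ t : ℝ, (v t).re = 1 / 2 + κ * t := fun t => by simp [hv]; ring
  have hvim : ∀ t : ℝ, (v t).im = κ + t / 2 := fun t => by simp [hv]; ring
  have hure : ∀ t : ℝ, (u t).re = 1 + t * (√2 / 2) := fun t => by simp [hu]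
  have hvI : ∀ t ∈ Set.Icc (0 : ℝ) 1, (v t).im ≠ 0 := fun t ht => by
    rw [hvim]; have := ht.1; positivity
  have hum : ∀ t ∈ Set.Icc (0 : ℝ) 1, u t ∈ Complex.slitPlane := fun t ht => by
    rw [Complex.mem_slitPlane_iff]; left; rw [hure]; have := ht.1; positivity
  have hv0 : ∀ t ∈ Set.Icc (0 : ℝ) 1, v t ≠ 0 := fun t ht h => hvI t ht (by rw [h]; rfl)
  have huv : ∀ t : ℝ, u t * (1 / 2 + κ * Complex.I) = v t := fun t => by
    simp only [hu, hv, hκ]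
    push_cast
    linear_combination ((t : ℂ) * Complex.I / 4 + t / 4) * hsC +
      (-(t : ℂ) * (√2 : ℝ) / 4 - t * (√2 : ℝ) ^ 2 / 4) * Complex.I_sq
  have hτw : ((√2 / 2 : ℝ) - (√2 / 2 : ℝ) * Complex.I : ℂ) * (1 / 2 + κ * Complex.I) =
      κ + 1 / 2 * Complex.I := by
    have h0 := huv 0
    have h1 := huv 1
    simp only [hu, hv, Complex.ofReal_zero, Complex.ofReal_one] at h0 h1
    linear_combination h1 - h0
  have hw0 : (1 / 2 + κ * Complex.I : ℂ) ≠ 0 := fun h => by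
    have := congrArg Complex.re h
    simp at this
  have h1v : ∀ t : ℝ, 1 - v t = -((t + Complex.I) * (κ + 1 / 2 * Complex.I)) := fun t => by
    simp only [hv]
    linear_combination (1 / 2 : ℂ) * Complex.I_sq
  have htI : ∀ t : ℝ, (t + Complex.I : ℂ) ≠ 0 := fun t h => by
    have := congrArg Complex.im h
    simp at this
  have hκI : (κ + 1 / 2 * Complex.I : ℂ) ≠ 0 := fun h => by
    have := congrArg Complex.im h
    simp at this
  have du : ∀ t : ℝ, HasDerivAt u ((√2 / 2 : ℝ) - (√2 / 2 : ℝ) * Complex.I) t := fun t => by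
    exact ((((hasDerivAt_id t).ofReal_comp).mul_const
      ((√2 / 2 : ℝ) - (√2 / 2 : ℝ) * Complex.I : ℂ)).const_add 1).congr_deriv (by simp)
  have dv : ∀ t : ℝ, HasDerivAt v (κ + 1 / 2 * Complex.I) t := fun t => by
    exact ((((hasDerivAt_id t).ofReal_comp).mul_const
      (κ + 1 / 2 * Complex.I : ℂ)).const_add (1 / 2 + κ * Complex.I)).congr_deriv (by simp)
  -- The integrand is log u(t)/(t+i). Normalizing v = u/u(-i) makes 1-v vanish exactly at t = -i, so
  -- log u · log(1-v) + Li₂(v) is a primitive.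
  have hval : MPL [(1, Complex.I), (1, theta)] =
      (Complex.log (u 1) * Complex.log (1 - v 1) + dilog (v 1)) -
      (Complex.log (u 0) * Complex.log (1 - v 0) + dilog (v 0)) := by
    rw [MPL_one_one Complex.I_ne_zero theta_ne_zero (by
      have := hum 1 ⟨zero_le_one, le_rfl⟩
      have h := hτ 1
      simp only [Complex.ofReal_one, one_mul] at h
      rw [h]
      simpa only [hu, Complex.ofReal_one, one_mul] using this)]
    refine integral_eq_sub_of_hasDerivAt
      (f := fun t => Complex.log (u t) * Complex.log (1 - v t) + dilog (v t)) ?_ ?_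
    · intro t ht
      rw [Set.uIcc_of_le zero_le_one] at ht
      have hm := one_sub_mem_slitPlane_of_im (hvI t ht)
      have d := (((du t).clog_real (hum t ht)).mul (((dv t).const_sub 1).clog_real hm)).add
        ((dv t).dilog hm (hv0 t ht))
      refine d.congr_deriv ?_
      rw [hτ]
      have nu := Complex.slitPlane_ne_zero (hum t ht)
      have e1 : (κ + 1 / 2 * Complex.I : ℂ) / v t =
          ((√2 / 2 : ℝ) - (√2 / 2 : ℝ) * Complex.I) / u t := by
        rw [← huv, ← hτw, mul_div_mul_right _ _ hw0]
      have e2 : -(κ + 1 / 2 * Complex.I : ℂ) / (1 - v t) = 1 / (t + Complex.I) := by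
        rw [h1v, neg_div_neg_eq, mul_comm (t + Complex.I : ℂ), div_mul_cancel_left₀ hκI, one_div]
      rw [e2, Complex.inv_I, sub_neg_eq_add]
      change _ = Complex.log (u t) / _
      linear_combination (-Complex.log (1 - v t)) * e1
    · apply ContinuousOn.intervalIntegrable
      intro t ht
      rw [Set.uIcc_of_le zero_le_one] at ht
      have c : ContinuousAt (fun t : ℝ => Complex.log (u t) / (t + Complex.I)) t :=
        ((du t).clog_real (hum t ht)).continuousAt.div (by fun_prop) (htI t)
      refine ContinuousAt.continuousWithinAt ?_
      simpa only [hτ, Complex.inv_I, sub_neg_eq_add] using c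
  -- polar forms at the end points
  have hp1 : 0 < 2 + √(2 : ℝ) := by positivity
  have hp2 : 0 < 2 - √(2 : ℝ) := by linarith
  have hP : √(2 + √2) ^ 2 = 2 + √(2 : ℝ) := Real.sq_sqrt hp1.le
  have hPQ : √(2 + √2) * √(2 - √2) = √(2 : ℝ) := by
    rw [← Real.sqrt_mul hp1.le]; congr 1; linear_combination -hs
  have hlogP : Real.log √(2 + √2) = Real.log 2 / 4 + Real.log (1 + √2) / 2 := by
    rw [Real.log_sqrt hp1.le, show 2 + √(2 : ℝ) = √2 * (1 + √2) by linear_combination -hs,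
      Real.log_mul (by positivity) (by positivity), log_sqrt_two]
    ring
  have hP0 : 0 < √(2 + √(2 : ℝ)) := Real.sqrt_pos.mpr hp1
  have c8 := Real.cos_pi_div_eight
  have s8 := Real.sin_pi_div_eight
  have hu1 : Complex.log (u 1) = Real.log √(2 + √2) + ((-(Real.pi / 8) : ℝ) : ℂ) * Complex.I := by
    rw [← log_mul_exp hP0 (by linarith) (by linarith)]
    congr 1
    apply Complex.ext
    · rw [Complex.re_ofReal_mul, Complex.exp_ofReal_mul_I_re, Real.cos_neg, c8, hure]
      linear_combination (-1 / 2) * hP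
    · rw [Complex.im_ofReal_mul, Complex.exp_ofReal_mul_I_im, Real.sin_neg, s8]
      simp [hu]
      linear_combination (-1 / 2) * hPQ
  have hv1 : Complex.log (1 - v 1) = Real.log √(2 + √2) + ((-(5 * Real.pi / 8) : ℝ) : ℂ) * Complex.I := by
    rw [← log_mul_exp hP0 (by linarith) (by linarith)]
    have c5 : Real.cos (5 * Real.pi / 8) = -Real.sin (Real.pi / 8) := by
      rw [show 5 * Real.pi / 8 = Real.pi / 8 + Real.pi / 2 by ring, Real.cos_add_pi_div_two]
    have s5 : Real.sin (5 * Real.pi / 8) = Real.cos (Real.pi / 8) := by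
      rw [show 5 * Real.pi / 8 = Real.pi / 8 + Real.pi / 2 by ring, Real.sin_add_pi_div_two]
    congr 1
    apply Complex.ext
    · rw [Complex.re_ofReal_mul, Complex.exp_ofReal_mul_I_re, Real.cos_neg, c5, s8, Complex.sub_re,
        hvre, Complex.one_re, hκ]
      linear_combination (1 / 2) * hPQ
    · rw [Complex.im_ofReal_mul, Complex.exp_ofReal_mul_I_im, Real.sin_neg, s5, c8, Complex.sub_im,
        hvim, Complex.one_im, hκ]
      linear_combination (1 / 2) * hP
  have hw : Complex.log (1 / 2 + κ * Complex.I) =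
      Real.log (√(2 + √2) / √2) + ((3 * Real.pi / 8 : ℝ) : ℂ) * Complex.I := by
    rw [← log_mul_exp (by positivity) (by linarith) (by linarith)]
    have c3 : Real.cos (3 * Real.pi / 8) = Real.sin (Real.pi / 8) := by
      rw [← Real.cos_pi_div_two_sub]; congr 1; ring
    have s3 : Real.sin (3 * Real.pi / 8) = Real.cos (Real.pi / 8) := by
      rw [← Real.sin_pi_div_two_sub]; congr 1; ring
    congr 1
    have hs0 := sqrt_two_ne_zero
    apply Complex.ext
    · rw [Complex.re_ofReal_mul, Complex.exp_ofReal_mul_I_re, c3, s8,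
        show √(2 + √2) / √2 * (√(2 - √2) / 2) = √(2 + √2) * √(2 - √2) / (2 * √2) by ring, hPQ]
      simp
      field_simp
    · rw [Complex.im_ofReal_mul, Complex.exp_ofReal_mul_I_im, s3, c8,
        show √(2 + √2) / √2 * (√(2 + √2) / 2) = √(2 + √2) ^ 2 / (2 * √2) by ring, hP]
      simp [hκ]
      field_simp
      linear_combination hs
  have hd0 := re_dilog_half_add hκ0.le
  rw [hw, Real.log_div hP0.ne' sqrt_two_ne_zero, hlogP, log_sqrt_two] at hd0
  have hd1 := re_dilog_theta_inversion (x := rho⁻¹) (by rw [rho_inv]; linarith [rho_pos])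
  rw [inv_inv, re_dilog_rho_mul_theta, Real.log_inv, log_rho] at hd1
  have hvt : v 1 = ((rho⁻¹ : ℝ) : ℂ) * theta := by
    rw [rho_inv, rho]
    apply Complex.ext
    · rw [hvre, Complex.re_ofReal_mul, theta_re, hκ]
      linear_combination (-1 / 2) * hs
    · rw [hvim, Complex.im_ofReal_mul, theta_im, hκ]
      linear_combination (-1 / 2) * hs
  have hu0 : Complex.log (u 0) = 0 := by simp [hu]
  have hv00 : v 0 = 1 / 2 + κ * Complex.I := by simp [hv]
  rw [reLi11, hval, hu0, hv00, hu1, hv1, hlogP, hvt]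
  simp only [zero_mul, zero_add, Complex.sub_re, Complex.add_re, hd0]
  rw [show (dilog (((rho⁻¹ : ℝ) : ℂ) * theta)).re = 11 * Real.pi ^ 2 / 96 -
    (reDilog rho / 2 + Real.pi ^ 2 / 192) - Real.log (1 + √2) ^ 2 / 2 by linear_combination hd1]
  simp only [Complex.mul_re, Complex.add_re, Complex.add_im, Complex.ofReal_re, Complex.ofReal_im,
    Complex.mul_im, Complex.I_re, Complex.I_im]
  ring

/-- A normal form linear in √2, which lets the final comparisons close by `ring` or one use of √2² =
2. -/
theorem div_sqrt_two (a c : ℝ) : a / (c * √2) = a / c * (√2 / 2) := by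
  rcases eq_or_ne c 0 with rfl | hc
  · simp
  have := sqrt_two_ne_zero
  field_simp
  rw [Real.sq_sqrt zero_le_two]

/-! ### Values of the basic series and integrals. -/

theorem hasSum_first_one : HasSum (fun n : ℕ => binomFactor (n + 1) / (2 * n + 1))
    ((intTwoSub (fun _ => 1) + 2 * intQuartic (fun _ => 1) - 4 * intSqQuartic (fun _ => 1)) / 5) := by
  refine (hasSum_integral_first intervalIntegrable_const).of_eq (fun n => ?_) rfl
  simp only [mul_one]
  rw [integral_evenBeta, evenBeta_first]

theorem hasSum_first_log : HasSum (fun n : ℕ => binomFactor (n + 1) / (2 * n + 1) *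
      -(oddHarmonic (3 * (n + 1)) - oddHarmonic n))
    ((intTwoSub Real.log + 2 * intQuartic Real.log - 4 * intSqQuartic Real.log) / 5) := by
  refine (hasSum_integral_first intervalIntegrable_log').of_eq (fun n => ?_) rfl
  rw [integral_evenBeta_log, ← evenBeta_first, show n + (2 * n + 2) + 1 = 3 * (n + 1) by ring]
  ring

theorem hasSum_first_log_one_sub_sq : HasSum (fun n : ℕ => binomFactor (n + 1) / (2 * n + 1) *
      (H (2 * (n + 1)) + 2 * Real.log 2 - 2 * oddHarmonic (3 * (n + 1))))
    ((intTwoSub (fun y => Real.log (1 - y ^ 2)) + 2 * intQuartic (fun y => Real.log (1 - y ^ 2)) -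
      4 * intSqQuartic (fun y => Real.log (1 - y ^ 2))) / 5) := by
  refine (hasSum_integral_first intervalIntegrable_log_one_sub_sq).of_eq (fun n => ?_) rfl
  rw [integral_evenBeta_log_one_sub_sq, ← evenBeta_first,
    show n + (2 * n + 2) + 1 = 3 * (n + 1) by ring, show 2 * (n + 1) = 2 * n + 2 by ring]
  ring

theorem hasSum_second_one : HasSum (fun n : ℕ => binomFactor (n + 1) / (n + 1))
    (4 / 5 * (-2 * intTwoSub (fun _ => 1) + intQuartic (fun _ => 1) +
      3 * intSqQuartic (fun _ => 1))) := by
  refine (hasSum_integral_second intervalIntegrable_const).of_eq (fun n => ?_) rfl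
  simp only [mul_one]
  rw [integral_evenBeta, evenBeta_second]

theorem hasSum_second_log : HasSum (fun n : ℕ => binomFactor (n + 1) / (n + 1) *
      -(oddHarmonic (3 * (n + 1)) - oddHarmonic (n + 1)))
    (4 / 5 * (-2 * intTwoSub Real.log + intQuartic Real.log + 3 * intSqQuartic Real.log)) := by
  refine (hasSum_integral_second intervalIntegrable_log').of_eq (fun n => ?_) rfl
  rw [integral_evenBeta_log, ← evenBeta_second, show n + 1 + (2 * n + 1) + 1 = 3 * (n + 1) by ring]
  ring

theorem hasSum_second_log_one_sub_sq : HasSum (fun n : ℕ => binomFactor (n + 1) / (n + 1) *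
      (H (2 * n + 1) + 2 * Real.log 2 - 2 * oddHarmonic (3 * (n + 1))))
    (4 / 5 * (-2 * intTwoSub (fun y => Real.log (1 - y ^ 2)) +
      intQuartic (fun y => Real.log (1 - y ^ 2)) +
      3 * intSqQuartic (fun y => Real.log (1 - y ^ 2)))) := by
  refine (hasSum_integral_second intervalIntegrable_log_one_sub_sq).of_eq (fun n => ?_) rfl
  rw [integral_evenBeta_log_one_sub_sq, ← evenBeta_second,
    show n + 1 + (2 * n + 1) + 1 = 3 * (n + 1) by ring]
  ring

theorem intTwoSub_sq_half : intTwoSub (fun y => y ^ 2 / 2) = intTwoSub (fun _ => 1) - 1 / 2 := by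
  have h1 : IntervalIntegrable (fun _ : ℝ => (1 : ℝ)) volume 0 1 := intervalIntegrable_const
  have e : (1 / 2 : ℝ) = ∫ _ in (0 : ℝ)..1, (1 / 2 : ℝ) := by simp
  rw [intTwoSub, intTwoSub, e, ← integral_sub (intervalIntegrable_div_two_sub_sq h1)
    intervalIntegrable_const]
  refine integral_congr fun y hy => ?_
  rw [Set.uIcc_of_le zero_le_one] at hy
  have := (two_sub_sq_pos hy).ne'
  field_simp
  ring

theorem intQuartic_sq_half : intQuartic (fun y => y ^ 2 / 2) = intSqQuartic (fun _ => 1) / 2 := by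
  rw [intQuartic, intSqQuartic, ← intervalIntegral.integral_div]
  congr 1; ext y; ring

theorem intSqQuartic_sq_half :
    intSqQuartic (fun y => y ^ 2 / 2) = 1 / 2 - intQuartic (fun _ => 1) / 2 := by
  have h1 : IntervalIntegrable (fun _ : ℝ => (1 : ℝ)) volume 0 1 := intervalIntegrable_const
  have e : (1 / 2 : ℝ) = ∫ _ in (0 : ℝ)..1, (1 / 2 : ℝ) := by simp
  rw [intQuartic, intSqQuartic, e, ← intervalIntegral.integral_div,
    ← integral_sub intervalIntegrable_const
      ((intervalIntegrable_div_one_add_pow_four h1).div_const 2)]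
  refine integral_congr fun y _ => ?_
  have : 1 + y ^ 4 ≠ 0 := by positivity
  field_simp
  ring

theorem hasSum_third : HasSum (fun n : ℕ => binomFactor (n + 1) / (2 * n + 1) ^ 2)
    (-intTwoSub (fun _ => 1) + (intQuartic (fun _ => 1) + intSqQuartic (fun _ => 1)) / 2 +
      intTwoSub Real.log - intQuartic Real.log + intSqQuartic Real.log) := by
  have hJ : IntervalIntegrable Real.log volume 0 1 := intervalIntegrable_log'
  have hw : IntervalIntegrable (fun y : ℝ => y ^ 2 / 2) volume 0 1 :=
    Continuous.intervalIntegrable (by fun_prop) _ _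
  have k := hasSum_integral_third (hw.sub (hJ.const_mul 1))
  rw [intTwoSub_sub hw hJ, intQuartic_sub hw hJ, intSqQuartic_sub hw hJ, intTwoSub_sq_half,
    intQuartic_sq_half, intSqQuartic_sq_half] at k
  refine k.of_eq (fun n => ?_) (by ring)
  rw [← evenBeta_third]
  simp only [one_mul]

/-- The values of the nine basic integrals. -/
theorem basic_integrals :
    intTwoSub (fun _ => 1) = √2 / 2 * Real.log (1 + √2) ∧
    intQuartic (fun _ => 1) = √2 / 2 * (Real.pi / 4 + Real.log (1 + √2) / 2) ∧
    intSqQuartic (fun _ => 1) = √2 / 2 * (Real.pi / 4 - Real.log (1 + √2) / 2) ∧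
    intTwoSub Real.log = -(√2 / 2) * (reDilog rho + Real.pi ^ 2 / 48 - Real.log 2 ^ 2 / 8 +
      (Real.log (1 + √2) - Real.log 2 / 2) ^ 2 / 2) ∧
    intQuartic Real.log = -LConst / 2 - √2 / 2 * (Real.pi ^ 2 / 16) ∧
    intSqQuartic Real.log = -LConst / 2 + √2 / 2 * (Real.pi ^ 2 / 16) ∧
    intTwoSub (fun y => Real.log (1 - y ^ 2)) =
      √2 / 2 * (2 * Real.log (1 + √2) ^ 2 - 5 * Real.pi ^ 2 / 12 + 4 * reDilog rho) := by
  have a1 := intTwoSub_one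
  have a2 := quartic_one_sub
  have a3 := quartic_one_add
  have a4 := intTwoSub_log
  obtain ⟨a5, a6⟩ := quartic_integrals_log
  have a7 := intTwoSub_log_one_sub_sq
  rw [reDilog_half] at a4
  have q : ∀ x : ℝ, x / √2 = x * (√2 / 2) := fun x => by simpa using div_sqrt_two x 1
  rw [q] at a1 a2 a4
  rw [div_sqrt_two] at a3 a7
  refine ⟨?_, ?_, ?_, ?_, ?_, ?_, ?_⟩
  · linear_combination a1
  · linear_combination (a2 + a3) / 2
  · linear_combination (a3 - a2) / 2
  · linear_combination a4
  · linear_combination (a5 + a6) / 2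
  · linear_combination (a6 - a5) / 2
  · linear_combination a7

theorem basic_integrals_quartic_log_one_sub_sq :
    intQuartic (fun y => Real.log (1 - y ^ 2)) = -LConst / 2 + √2 / 2 * (Real.pi * Real.log 2 / 8 -
      Real.pi ^ 2 / 16 + Real.log 2 * Real.log (1 + √2) / 2) +
      intTwoSub (fun y => Real.log (1 - y ^ 2)) / 4 - intTwoSub Real.log / 2 ∧
    intSqQuartic (fun y => Real.log (1 - y ^ 2)) = -LConst / 2 + √2 / 2 * (Real.pi * Real.log 2 / 8 +
      Real.pi ^ 2 / 16 - Real.log 2 * Real.log (1 + √2) / 2) -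
      intTwoSub (fun y => Real.log (1 - y ^ 2)) / 4 + intTwoSub Real.log / 2 := by
  have b1 := quartic_log_one_sub_sq_sub
  have b2 := quartic_log_one_sub_sq_add
  obtain ⟨a5, a6⟩ := quartic_integrals_log
  have q : ∀ x : ℝ, x / √2 = x * (√2 / 2) := fun x => by simpa using div_sqrt_two x 1
  rw [q] at b1
  rw [div_sqrt_two] at b2
  constructor
  · linear_combination b1 / 4 + b2 / 2 + a5 / 2 + a6 / 2
  · linear_combination b2 / 2 - b1 / 4 - a5 / 2 + a6 / 2

theorem H_mul_succ_sub_one (m n : ℕ) (hm : 0 < m) :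
    H (m * (n + 1) - 1) = H (m * (n + 1)) - 1 / (m * ((n : ℝ) + 1)) := by
  obtain ⟨j, hj⟩ : ∃ j, m * (n + 1) = j + 1 :=
    Nat.exists_eq_succ_of_ne_zero (Nat.mul_ne_zero hm.ne' (Nat.succ_ne_zero n))
  have hj' : (m : ℝ) * ((n : ℝ) + 1) = (j : ℝ) + 1 := by exact_mod_cast hj
  rw [hj, hj', H_succ, Nat.add_sub_cancel]
  ring

/-! ### Assembly of the seven series. -/

theorem mainTheorem3 :
    HasSumFromOne (fun k => binomFactor k / (2 * (k : ℝ) - 1))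
      (2 * √2 * Real.log (1 + √2) / 5 - Real.pi / (10 * √2)) ∧
    HasSumFromOne
      (fun k => (-H k + 2 * H (2 * k) + H (3 * k) - 2 * H (6 * k) - 2 / (2 * (k : ℝ) - 1)) *
        binomFactor k / (2 * (k : ℝ) - 1))
      (2 * √2 * (reLi11 + imLi2 - catalanG / 4) / 5
        - 3 * Real.log 2 ^ 2 / (40 * √2)
        + Real.log 2 * Real.log (1 + √2) / (10 * √2)
        - Real.log (1 + √2) ^ 2 / (10 * √2)
        - 83 * Real.pi ^ 2 / (480 * √2)) ∧
    HasSumFromOne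
      (fun k => (H k - H (2 * k) + 2 / (2 * (k : ℝ) - 1) + 2 * Real.log 2) *
        binomFactor k / (2 * (k : ℝ) - 1))
      (-(√2 * (15 * reLi11 + imLi2 - catalanG / 4) / 5)
        + 9 * Real.log 2 ^ 2 / (16 * √2)
        + 17 * Real.log 2 * Real.log (1 + √2) / (20 * √2)
        + 3 * Real.log (1 + √2) ^ 2 / (4 * √2)
        - Real.pi * Real.log 2 / (20 * √2)
        - Real.pi ^ 2 / (320 * √2)) ∧
    HasSumFromOne (fun k => binomFactor k / (2 * (k : ℝ) - 1) ^ 2)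
      (√2 * reLi11
        - 3 * Real.log 2 ^ 2 / (16 * √2)
        + Real.log 2 * Real.log (1 + √2) / (4 * √2)
        - Real.log (1 + √2) / √2
        - Real.log (1 + √2) ^ 2 / (4 * √2)
        + Real.pi / (4 * √2)
        + 13 * Real.pi ^ 2 / (192 * √2)) ∧
    HasSumFromOne
      (fun k => ((5 * (k : ℝ) - 1) * (H (2 * k - 1) - H (k - 1))
          - 3 * (6 * (k : ℝ) - 1) / (4 * (2 * (k : ℝ) - 1))) *
        binomFactor k / ((k : ℝ) * (2 * (k : ℝ) - 1)))
      (3 * √2 * Real.pi * Real.log 2 / 8 - LConst) ∧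
    HasSumFromOne
      (fun k => ((5 * (k : ℝ) - 1) * (2 * H (6 * k - 1) - H (3 * k - 1) - H (k - 1))
          - 2 * (3 * (k : ℝ) - 1) / (2 * (k : ℝ) - 1)) *
        binomFactor k / ((k : ℝ) * (2 * (k : ℝ) - 1)))
      (3 * √2 * Real.pi * Real.log 2 / 4) ∧
    HasSumFromOne
      (fun k => ((5 * (k : ℝ) - 1) *
          (12 * H (6 * k - 1) - 6 * H (3 * k - 1) - 4 * H (2 * k - 1) - 2 * H (k - 1)) - 9) *
        binomFactor k / ((k : ℝ) * (2 * (k : ℝ) - 1)))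
      (3 * √2 * Real.pi * Real.log 2 + 4 * LConst) := by
  have hs : √(2 : ℝ) ^ 2 = 2 := Real.sq_sqrt (by norm_num)
  obtain ⟨vE0, vE1, vE2, vJ0, vJ1, vJ2, vK0⟩ := basic_integrals
  obtain ⟨vK1, vK2⟩ := basic_integrals_quartic_log_one_sub_sq
  rw [vK0, vJ0] at vK1 vK2
  have vI : imLi2 = catalanG / 4 + LConst * (√2 / 2) := by
    have h := imLi2_sub_catalanG
    rw [show LConst / √2 = LConst * (√2 / 2) by simpa using div_sqrt_two LConst 1] at h
    linarith
  have vR := reLi11_eq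
  have q : ∀ x : ℝ, x / √2 = x * (√2 / 2) := fun x => by simpa using div_sqrt_two x 1
  have s1 := hasSum_first_one
  have s2 := hasSum_first_log
  have s3 := hasSum_first_log_one_sub_sq
  have t1 := hasSum_second_one
  have t2 := hasSum_second_log
  have t3 := hasSum_second_log_one_sub_sq
  have d := hasSum_third
  rw [vE0, vE1, vE2] at s1 t1
  rw [vJ0, vJ1, vJ2] at s2 t2
  rw [vK0, vK1, vK2] at s3 t3
  rw [vE0, vE1, vE2, vJ0, vJ1, vJ2] at d
  have n1 : ∀ n : ℕ, 2 * (((n + 1 : ℕ) : ℝ)) - 1 = 2 * n + 1 := fun n => by push_cast; ring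
  have p1 : ∀ n : ℕ, 2 * (n : ℝ) + 1 ≠ 0 := fun n => by positivity
  have p2 : ∀ n : ℕ, (n : ℝ) + 1 ≠ 0 := fun n => by positivity
  have o3 : ∀ n : ℕ, oddHarmonic (3 * (n + 1)) = H (6 * (n + 1)) - H (3 * (n + 1)) / 2 := fun n => by
    rw [oddHarmonic, show 2 * (3 * (n + 1)) = 6 * (n + 1) by ring]
  have o1 : ∀ n : ℕ, oddHarmonic (n + 1) = H (2 * (n + 1)) - H (n + 1) / 2 := fun n => rfl
  have o0 : ∀ n : ℕ, oddHarmonic n = H (2 * (n + 1)) - H (n + 1) / 2 - 1 / (2 * (n : ℝ) + 1) :=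
    fun n => by rw [← o1, oddHarmonic_succ]; ring
  have h2 : ∀ n : ℕ, H (2 * n + 1) = H (2 * (n + 1)) - 1 / (2 * ((n : ℝ) + 1)) := fun n => by
    have := H_mul_succ_sub_one 2 n two_pos
    rwa [show 2 * (n + 1) - 1 = 2 * n + 1 by lia] at this
  have h1 : ∀ n : ℕ, H (n + 1 - 1) = H (n + 1) - 1 / ((n : ℝ) + 1) := fun n => by
    rw [Nat.add_sub_cancel, H_succ]; ring
  have c5 : HasSumFromOne
      (fun k => ((5 * (k : ℝ) - 1) * (H (2 * k - 1) - H (k - 1))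
          - 3 * (6 * (k : ℝ) - 1) / (4 * (2 * (k : ℝ) - 1))) *
        binomFactor k / ((k : ℝ) * (2 * (k : ℝ) - 1)))
      (3 * √2 * Real.pi * Real.log 2 / 8 - LConst) := by
    -- The weight is log(4y²/(1-y²)), taken with (5k-1)/(k(2k-1)) = 1/k + 3/(2k-1); the partial sums
    -- over 3k cancel. The last three series adjust rational terms from index shifts.
    refine HasSum.of_eq ((((t2.mul_left 2).sub t3).add (t1.mul_left (2 * Real.log 2))).add
      ((((s2.mul_left 6).sub (s3.mul_left 3)).add (s1.mul_left (6 * Real.log 2))).add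
      (((t1.mul_left (-3 / 4)).add (s1.mul_left (3 / 2))).add (d.mul_left 3)))) (fun n => ?_) ?_
    · have := p1 n
      have := p2 n
      beta_reduce
      rw [n1, H_mul_succ_sub_one 2 n two_pos, h1, h2, o3, o1, o0]
      push_cast
      field_simp
      ring
    · ring
  have c6 : HasSumFromOne
      (fun k => ((5 * (k : ℝ) - 1) * (2 * H (6 * k - 1) - H (3 * k - 1) - H (k - 1))
          - 2 * (3 * (k : ℝ) - 1) / (2 * (k : ℝ) - 1)) *
        binomFactor k / ((k : ℝ) * (2 * (k : ℝ) - 1)))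
      (3 * √2 * Real.pi * Real.log 2 / 4) := by
    -- The same with weight 2 log(4y/(1-y²)), whose term is 2H_{6k} - H_{3k} - H_k up to rational
    -- corrections.
    refine HasSum.of_eq ((((t2.mul_left 2).sub (t3.mul_left 2)).add
      (t1.mul_left (4 * Real.log 2))).add
      ((((s2.mul_left 6).sub (s3.mul_left 6)).add (s1.mul_left (12 * Real.log 2))).add
      (((t1.mul_left (-1)).add (s1.mul_left 2)).add (d.mul_left 4)))) (fun n => ?_) ?_
    · have := p1 n
      have := p2 n
      beta_reduce
      rw [n1, H_mul_succ_sub_one 6 n (by norm_num), H_mul_succ_sub_one 3 n (by norm_num), h1, h2,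
        o3, o1, o0]
      push_cast
      field_simp
      ring
    · ring
  refine ⟨?_, ?_, ?_, ?_, c5, c6, ?_⟩
  · refine s1.of_eq (fun n => by beta_reduce; rw [n1]) ?_
    rw [div_sqrt_two]
    ring
  -- Weight 2 log y.
  · refine (s2.mul_left 2).of_eq (fun n => ?_) ?_
    · have := p1 n
      beta_reduce
      rw [n1, o3, o0]
      field_simp
      ring
    · simp only [div_sqrt_two, vI, vR]
      linear_combination LConst / 5 * hs
  -- Weight log(1-y²) - 2 log y, which removes the sums over 3k.
  · refine (s3.sub (s2.mul_left 2)).of_eq (fun n => ?_) ?_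
    · have := p1 n
      beta_reduce
      rw [n1, o3, o0]
      field_simp
      ring
    · simp only [div_sqrt_two, vI, vR]
      linear_combination -LConst / 10 * hs
  · refine d.of_eq (fun n => by beta_reduce; rw [n1]) ?_
    simp only [div_sqrt_two, q, vR]
    ring
  -- The rational parts combine by 12(3k-1) - 3(6k-1) = 9(2k-1) to the constant -9.
  · refine HasSum.of_eq ((c6.mul_left 6).sub (c5.mul_left 4)) (fun n => ?_) (by ring)
    have := p1 n
    have := p2 n
    beta_reduce
    rw [n1]
    push_cast
    field_simp
    ring
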